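/- **Setting.** For every $N\ge 1$ let $M$ be a random Hermitian $N\times N$ matrix all of whose moments are finite, with law depending on $N$. Let $K_N(J)=\log\langle\exp \mathrm{Tr}(MJ)\rangle$ be the generating function of its joint cumulants, a formal power series in the entries of a source matrix $J$. An oriented graph $G$ is a finite directed graph without isolated vertices, with loops and multiple edges allowed; $v(G),e(G),c(G)$ are its numbers of vertices, edges and connected components, $s(e),t(e)$ the source and target of an edge $e$; $G$ is Eulerian if every vertex has as many incoming as outgoing edges (connectedness is not required). For pairwise distinct indices $i_1,\dots,i_{v(G)}\in\{1,\dots,N\}$ let $$C_G(i_1,\dots,i_{v(G)})=\Big\langle\prod_{e}M_{i_{s(e)}i_{t(e)}}\Big\rangle_{\mathrm c}=\prod_e\frac{\partial}{\partial J_{i_{t(e)}i_{s(e)}}}K_N(J)\Big|_{J=0}.$$ Let $\alpha\in\mathbb R$ be independent of $N$, let $C'_G$ be the Gaussian cumulants with generating series $\frac{\alpha^2}{2}\mathrm{Tr}(J^2)$ (the only non-vanishing ones are given by $\langle M_{ij}M_{kl}\rangle_{\mathrm c}=\alpha^2\delta_{il}\delta_{jk}$), and put $C''_G=C_G-C'_G$.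 Assume that, uniformly in the distinct indices $i_1,\dots,i_{v(G)}$, as $N\to\infty$, * $N^{v(G)-c(G)-e(G)/2}\,C''_G(i_1,\dots,i_{v(G)})\to 0$ for every Eulerian $G$; * $N^{v(G)-c(G)-e(G)/2}\,C''_G(i_1,\dots,i_{v(G)})$ is bounded for every non-Eulerian $G$. **Effective potential.** For $n$ replicas let $X=(X_{i,a})$, $1\le i\le N$, $1\le a\le n$, be a matrix of formal variables, with conjugate variables $\overline X_{i,a}$ and $(XX^\dagger)_{ij}=\sum_a X_{i,a}\overline X_{j,a}$. The effective potential $V(t;X,X^\dagger)$ is the unique formal power series in $t$, with coefficients formal power series in $X,\overline X$, such that $$\frac{\partial V}{\partial t}=\sum_{i,a}\Big(\frac{\partial^2V}{\partial X_{i,a}\partial\overline X_{i,a}}+\frac{\partial V}{\partial X_{i,a}}\frac{\partial V}{\partial\overline X_{i,a}}\Big),\qquad V(0;X,X^\dagger)=K_N\Big(\frac{XX^\dagger}{\sqrt N}\Big).$$ Let $V'$ be the solution with the initial value $\frac{\alpha^2}{2N}\mathrm{Tr}(X^\dagger XX^\dagger X)$ instead, and $V''=V-V'$, the part that contains at least one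 occurrence of the perturbation. **Proposition.** For every $N\geq 1$ and $k\ge0$ the coefficients of $t^k$ in $V'$ and in $V''$ have an expansion, valid for every number $n$ of replicas, of the form $$\sum_{G}\frac{1}{|\mathrm{Aut}(G)|\,N^{e(G)/2}}\sum_{\substack{1\le i_1,\dots,i_{v(G)}\le N\\ \text{all different}}}C^{(k)}_G(i_1,\dots,i_{v(G)})\prod_{e}(XX^\dagger)_{i_{t(e)}i_{s(e)}},$$ the sum being over isomorphism classes of oriented graphs, with coefficients $C_G^{(k)}=C_G'^{(k)}$ and $C_G^{(k)}=C_G''^{(k)}$ respectively, which are polynomials in $n$ and depend only on the isomorphism class of $G$ with indices on its vertices. For any such coefficients, let $[\,\cdot\,]_0$ denote the term of order $0$ in $n$. Then for every $k\ge 0$ and every oriented graph $G$, uniformly in the distinct indices $i_1,\dots,i_{v(G)}$, as $N\to\infty$, * $N^{v(G)-c(G)-e(G)/2}\,[C_G'^{(k)}(i_1,\dots,i_{v(G)})]_0$ is bounded; * $N^{v(G)-c(G)-e(G)/2}\,[C_G''^{(k)}(i_1,\dots,i_{v(G)})]_0\to0$ if $G$ is Eulerian; * $N^{v(G)-c(G)-e(G)/2}\,[C_G''^{(k)}(i_1,\dots,i_{v(G)})]_0$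 is bounded if $G$ is not Eulerian. (The bounds and rates may depend on $G$, on $k$ and on the sequence of laws, but not on the indices.) -/

import Mathlib

open MeasureTheory

noncomputable section

namespace ReplicaWigner

/-! ### Oriented graphs -/

/-- A finite oriented graph (loops and multiple edges allowed) without isolated vertices. -/
structure OrientedGraph where
  /-- number of vertices -/
  v : ℕ
  /-- number of edges -/
  e : ℕ
  /-- source of an edge -/
  src : Fin e → Fin v
  /-- target of an edge -/
  tgt : Fin e → Fin v
  /-- the vertices are exactly the ends of the edges -/
  no_isolated : ∀ x, ∃ a, src a = x ∨ tgt a = x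

namespace OrientedGraph

/-- Isomorphisms of oriented graphs: compatible bijections of the vertices and of the edges. -/
structure Iso (G H : OrientedGraph) where
  onV : Fin G.v ≃ Fin H.v
  onE : Fin G.e ≃ Fin H.e
  src_comm : ∀ a, H.src (onE a) = onV (G.src a)
  tgt_comm : ∀ a, H.tgt (onE a) = onV (G.tgt a)

/-- The identity isomorphism. -/
def Iso.refl (G : OrientedGraph) : Iso G G :=
  ⟨Equiv.refl _, Equiv.refl _, fun _ => rfl, fun _ => rfl⟩

/-- The inverse isomorphism. -/
def Iso.symm {G H : OrientedGraph} (φ : Iso G H) : Iso H G where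
  onV := φ.onV.symm
  onE := φ.onE.symm
  src_comm a := by
    rw [Equiv.eq_symm_apply, ← φ.src_comm, Equiv.apply_symm_apply]
  tgt_comm a := by
    rw [Equiv.eq_symm_apply, ← φ.tgt_comm, Equiv.apply_symm_apply]

/-- The composition of two isomorphisms. -/
def Iso.trans {G H K : OrientedGraph} (φ : Iso G H) (ψ : Iso H K) : Iso G K where
  onV := φ.onV.trans ψ.onV
  onE := φ.onE.trans ψ.onE
  src_comm a := by simp [ψ.src_comm, φ.src_comm]
  tgt_comm a := by simp [ψ.tgt_comm, φ.tgt_comm]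

instance isoSetoid : Setoid OrientedGraph where
  r G H := Nonempty (Iso G H)
  iseqv :=
    { refl := fun G => ⟨Iso.refl G⟩
      symm := fun ⟨φ⟩ => ⟨φ.symm⟩
      trans := fun ⟨φ⟩ ⟨ψ⟩ => ⟨φ.trans ψ⟩ }

/-- The order of the automorphism group of `G`. -/
def cardAut (G : OrientedGraph) : ℕ := Nat.card (Iso G G)

/-- The number of connected components (of the underlying unoriented graph). -/
def c (G : OrientedGraph) : ℕ :=
  Nat.card (Quot fun x y : Fin G.v => ∃ a, G.src a = x ∧ G.tgt a = y)

/-- Every vertex has as many incoming as outgoing edges. -/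
def IsEulerian (G : OrientedGraph) : Prop :=
  ∀ x, Nat.card {a // G.tgt a = x} = Nat.card {a // G.src a = x}

/-- The scaling factor `N ^ (v - c - e / 2)`. -/
def scaling (G : OrientedGraph) (N : ℕ) : ℝ :=
  (N : ℝ) ^ ((G.v : ℝ) - (G.c : ℝ) - (G.e : ℝ) / 2)

/-- The scaled functions of pairwise distinct vertex indices are bounded, uniformly in
the indices and in `N`. -/
def UniformlyBounded (G : OrientedGraph) (f : (N : ℕ) → (Fin G.v ↪ Fin N) → ℂ) : Prop :=
  ∃ B : ℝ, ∀ N : ℕ, 1 ≤ N → ∀ i : Fin G.v ↪ Fin N, G.scaling N * ‖f N i‖ ≤ B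

/-- The scaled functions of pairwise distinct vertex indices tend to zero as `N → ∞`,
uniformly in the indices. -/
def UniformlyVanishing (G : OrientedGraph) (f : (N : ℕ) → (Fin G.v ↪ Fin N) → ℂ) : Prop :=
  ∀ ε : ℝ, 0 < ε → ∃ N₀ : ℕ, ∀ N : ℕ, N₀ ≤ N →
    ∀ i : Fin G.v ↪ Fin N, G.scaling N * ‖f N i‖ ≤ ε

end OrientedGraph

/-- Isomorphism classes of oriented graphs. -/
abbrev GraphClass : Type := Quotient OrientedGraph.isoSetoid

/-! ### Cumulants of a random matrix -/

/-- Formal power series in the entries `J i j` of a source matrix. -/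
abbrev SourceSeries (N : ℕ) : Type := MvPowerSeries (Fin N × Fin N) ℂ

/-- `⟨exp Tr (M J)⟩` as a formal power series in `J`, where `Tr (M J) = ∑ M b a * J a b`. -/
def momentSeries {N : ℕ} {Ω : Type*} [MeasurableSpace Ω] (P : Measure Ω)
    (M : Ω → Matrix (Fin N) (Fin N) ℂ) : SourceSeries N :=
  fun d => (∫ ω, ∏ p : Fin N × Fin N, (M ω p.2 p.1) ^ d p ∂P) /
    (∏ p : Fin N × Fin N, ((d p).factorial : ℂ))

/-- `log ⟨exp Tr (M J)⟩` as a formal power series in `J`. -/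
def cumulantSeries {N : ℕ} {Ω : Type*} [MeasurableSpace Ω] (P : Measure Ω)
    (M : Ω → Matrix (Fin N) (Fin N) ℂ) : SourceSeries N :=
  (PowerSeries.log ℂ).subst (momentSeries P M - 1)

/-- The generating series `(α ^ 2 / 2) Tr (J ^ 2)` of the Gaussian cumulants: the only
non-vanishing one is `⟨M i j * M k l⟩ = α ^ 2 δ i l δ j k`. -/
def gaussianSeries (N : ℕ) (α : ℝ) : SourceSeries N :=
  MvPowerSeries.C ((α : ℂ) ^ 2 / 2) *
    ∑ i : Fin N, ∑ j : Fin N, MvPowerSeries.X (i, j) * MvPowerSeries.X (j, i)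

/-- The number of derivatives with respect to each `J j i` needed to produce the cumulant of
the entries `M (i (src a)) (i (tgt a))`, `a` running over the edges of `G`. -/
def edgeExponent {N : ℕ} (G : OrientedGraph) (i : Fin G.v ↪ Fin N) : Fin N × Fin N →₀ ℕ :=
  ∑ a : Fin G.e, Finsupp.single (i (G.tgt a), i (G.src a)) 1

/-- The cumulant `⟨∏ₐ M (i (src a)) (i (tgt a))⟩`, that is, the derivative at the origin of
the generating series `K` with respect to the `J (i (tgt a)) (i (src a))`. -/
def graphCumulant {N : ℕ} (K : SourceSeries N) (G : OrientedGraph)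
    (i : Fin G.v ↪ Fin N) : ℂ :=
  (∏ p : Fin N × Fin N, ((edgeExponent G i p).factorial : ℂ)) *
    MvPowerSeries.coeff (edgeExponent G i) K

/-! ### Replicas and the effective potential -/

/-- The variables `X i a` (left) and their conjugates (right), `i < N`, `a < n`. -/
abbrev RepVar (N n : ℕ) : Type := (Fin N × Fin n) ⊕ (Fin N × Fin n)

/-- Formal power series in `X` and `X†`. -/
abbrev RepSeries (N n : ℕ) : Type := MvPowerSeries (RepVar N n) ℂ

/-- The entry `(X X†) i j`. -/
def gram {N : ℕ} (n : ℕ) (i j : Fin N) : RepSeries N n :=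
  ∑ a : Fin n, MvPowerSeries.X (Sum.inl (i, a)) * MvPowerSeries.X (Sum.inr (j, a))

/-- The bare potential: `J = X X† / √N` in a generating series of cumulants. -/
def barePotential {N : ℕ} (n : ℕ) (K : SourceSeries N) : RepSeries N n :=
  K.subst fun p : Fin N × Fin N =>
    MvPowerSeries.C (((Real.sqrt N)⁻¹ : ℝ) : ℂ) * gram n p.1 p.2

/-- Derivative with respect to one replica variable of a formal power series in `t`. -/
def diffRep {N n : ℕ} (x : RepVar N n) (V : PowerSeries (RepSeries N n)) :
    PowerSeries (RepSeries N n) :=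
  PowerSeries.mk fun k => MvPowerSeries.pderiv ℂ x (PowerSeries.coeff k V)

/-- `V` solves the Polchinski equation
`∂V/∂t = ∑ i a, (∂²V/∂X∂X̄ + ∂V/∂X * ∂V/∂X̄)`, with value `V₀` at `t = 0`. -/
def IsPolchinskiSolution {N n : ℕ} (V₀ : RepSeries N n) (V : PowerSeries (RepSeries N n)) :
    Prop :=
  PowerSeries.coeff 0 V = V₀ ∧
    PowerSeries.derivative (RepSeries N n) V =
      ∑ p : Fin N × Fin n,
        (diffRep (Sum.inl p) (diffRep (Sum.inr p) V) +
          diffRep (Sum.inl p) V * diffRep (Sum.inr p) V)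

/-- The coefficients in powers of `t` of the iterative solution of the integrated equation. -/
def effCoeff {N n : ℕ} (V₀ : RepSeries N n) : ℕ → RepSeries N n
  | 0 => V₀
  | k + 1 => MvPowerSeries.C ((k + 1 : ℂ)⁻¹) * ∑ p : Fin N × Fin n,
      (MvPowerSeries.pderiv ℂ (Sum.inl p) (MvPowerSeries.pderiv ℂ (Sum.inr p) (effCoeff V₀ k)) +
        ∑ m : Fin (k + 1), MvPowerSeries.pderiv ℂ (Sum.inl p) (effCoeff V₀ m) *
          MvPowerSeries.pderiv ℂ (Sum.inr p) (effCoeff V₀ (k - m)))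
  termination_by k => k
  decreasing_by all_goals omega

/-- The effective potential with bare potential `V₀`, as a formal power series in `t`. -/
def effectivePotential {N n : ℕ} (V₀ : RepSeries N n) : PowerSeries (RepSeries N n) :=
  PowerSeries.mk (effCoeff V₀)

/-- The right-hand side of the Polchinski equation, order by order in `t`. -/
theorem coeff_rhs {N n : ℕ} (V : PowerSeries (RepSeries N n)) (k : ℕ) :
    PowerSeries.coeff k (∑ p : Fin N × Fin n,
        (diffRep (Sum.inl p) (diffRep (Sum.inr p) V) +
          diffRep (Sum.inl p) V * diffRep (Sum.inr p) V)) =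
      ∑ p : Fin N × Fin n,
        (MvPowerSeries.pderiv ℂ (Sum.inl p)
            (MvPowerSeries.pderiv ℂ (Sum.inr p) (PowerSeries.coeff k V)) +
          ∑ m : Fin (k + 1), MvPowerSeries.pderiv ℂ (Sum.inl p) (PowerSeries.coeff m V) *
            MvPowerSeries.pderiv ℂ (Sum.inr p) (PowerSeries.coeff (k - m) V)) := by
  rw [map_sum]
  refine Finset.sum_congr rfl fun p _ => ?_
  rw [map_add, PowerSeries.coeff_mul, Finset.Nat.sum_antidiagonal_eq_sum_range_succ_mk,
    Finset.sum_range]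
  simp [diffRep]

/-- The effective potential is the unique formal solution of the Polchinski equation. -/
theorem isPolchinskiSolution_iff {N n : ℕ} (V₀ : RepSeries N n)
    (V : PowerSeries (RepSeries N n)) :
    IsPolchinskiSolution V₀ V ↔ V = effectivePotential V₀ := by
  have key : ∀ (k : ℕ) (A B : RepSeries N n),
      A * ((k : RepSeries N n) + 1) = B ↔ A = MvPowerSeries.C ((k + 1 : ℂ)⁻¹) * B := by
    intro k A B
    have hk : (k + 1 : ℂ) ≠ 0 := Nat.cast_add_one_ne_zero k
    have h1 : ((k : RepSeries N n) + 1) = MvPowerSeries.C (k + 1 : ℂ) := by simp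
    have h2 : MvPowerSeries.C ((k + 1 : ℂ)⁻¹) * ((k : RepSeries N n) + 1) = 1 := by
      rw [h1, ← map_mul, inv_mul_cancel₀ hk, map_one]
    constructor
    · rintro rfl
      rw [mul_comm A, ← mul_assoc, h2, one_mul]
    · rintro rfl
      rw [mul_assoc, mul_comm B, ← mul_assoc, h2, one_mul]
  constructor
  · rintro ⟨h0, h⟩
    ext1 k
    rw [effectivePotential, PowerSeries.coeff_mk]
    induction k using Nat.strong_induction_on with
    | _ k ih =>
      cases k with
      | zero => rw [h0, effCoeff]
      | succ k =>
        have hk := congrArg (PowerSeries.coeff k) h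
        rw [PowerSeries.coeff_derivative, coeff_rhs, key] at hk
        rw [hk, effCoeff]
        congr 1
        refine Finset.sum_congr rfl fun p _ => ?_
        rw [ih k (by omega)]
        congr 1
        refine Finset.sum_congr rfl fun m _ => ?_
        rw [ih m (by omega), ih (k - m) (by omega)]
  · rintro rfl
    refine ⟨by rw [effectivePotential, PowerSeries.coeff_mk, effCoeff], ?_⟩
    ext1 k
    rw [PowerSeries.coeff_derivative, coeff_rhs, key]
    simp only [effectivePotential, PowerSeries.coeff_mk]
    rw [effCoeff]

/-- The Gaussian part `V'` of the effective potential: the bare potential is the quartic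
interaction `(α ^ 2 / (2 N)) Tr (X† X X† X)` alone. -/
def gaussianPart (N n : ℕ) (α : ℝ) : PowerSeries (RepSeries N n) :=
  effectivePotential (barePotential n (gaussianSeries N α))

/-- The part `V''` of the effective potential with at least one occurrence of the perturbation:
the effective potential of the matrix with cumulant series `K` minus its Gaussian part. -/
def perturbedPart {N : ℕ} (n : ℕ) (α : ℝ) (K : SourceSeries N) : PowerSeries (RepSeries N n) :=
  effectivePotential (barePotential n K) - gaussianPart N n α

/-! ### Expansion over oriented graphs -/

/-- Candidate coefficients `C_G(i₁, …, i_v)`, functions of pairwise distinct indices with values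
in the polynomials in the number `n` of replicas. -/
abbrev GraphCoeff (N : ℕ) : Type :=
  (G : OrientedGraph) → (Fin G.v ↪ Fin N) → Polynomial ℂ

/-- The contribution of the graph `G` to the expansion. -/
def graphTerm {N : ℕ} (n : ℕ) (C : GraphCoeff N) (G : OrientedGraph) : RepSeries N n :=
  MvPowerSeries.C (((G.cardAut : ℂ) * (((N : ℝ) ^ ((G.e : ℝ) / 2) : ℝ) : ℂ))⁻¹) *
    ∑ i : Fin G.v ↪ Fin N, MvPowerSeries.C ((C G i).eval (n : ℂ)) *
      ∏ a : Fin G.e, gram n (i (G.tgt a)) (i (G.src a))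

/-- The series `V n`, one for each number `n` of replicas, have the graph expansion
`∑_G 1 / (|Aut G| N ^ (e / 2)) ∑_i C_G(i) ∏ₐ (X X†) (i (tgt a)) (i (src a))`, the sum being over
isomorphism classes of graphs; the coefficients depend only on the isomorphism
class of the graph with indices on its vertices, and polynomially on `n`. -/
def IsGraphExpansion {N : ℕ} (V : (n : ℕ) → RepSeries N n) (C : GraphCoeff N) : Prop :=
  (∀ (G H : OrientedGraph) (φ : G.Iso H) (i : Fin H.v ↪ Fin N),
    C G (φ.onV.toEmbedding.trans i) = C H i) ∧
  ∀ (n : ℕ) (d : RepVar N n →₀ ℕ),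
    HasSum (fun G : GraphClass => MvPowerSeries.coeff d (graphTerm n C G.out))
      (MvPowerSeries.coeff d (V n))

end ReplicaWigner

end

noncomputable section

namespace ReplicaWigner

/-! ### The flow in terms of the source matrix -/

section ChainRule

open MvPowerSeries
open scoped MvPowerSeries.WithPiTopology

/-! The Polchinski flow preserves functions of `X X†`. By the chain rule, the flow started at `K (X
X† / √N)` is the image, under the substitution `bareHom`, of a flow on series in the source `J`
(`effCoeff_barePotential`). There the number of replicas enters only as a scalar in front of
`replicaTerm`. The coefficients are therefore polynomials in that number, and order 0 keeps only
`loopTerm` and `treeTerm`.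

Monomials in `J` are oriented graphs with distinct indices on the vertices. Counting labelings
against automorphisms (`card_labelings`) turns any source series into a graph expansion. Conversely,
for `n ≥ N` the substitution is injective, and polynomials are determined by their values at
infinitely many integers. Hence every graph expansion has at order 0 the coefficients of the flow at
`z = 0` (`eq_of_isGraphExpansion`).

For power counting, `v - c` is the rank of the span of the differences of the ends of the edges, so
that ranks of graphs become dimensions of subspaces. Read backwards, both remaining terms replace an
edge `i → l` by `i → j`, `j → l` and sum over `j`. After the factor `1 / √N` and the extra edge have
cancelled, each `j` contributes `N` to the old rank minus the new one. Boundedly many `j` are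
already vertices. Any other `j` raises the rank by one, and the resulting `1 / N` pays for the sum
over `j` (`sum_subdivide_le`). For trees the rank of a union is at most the sum of the ranks, so
bounds propagate.

The difference from the Gaussian flow is treated with the imbalance, the vector of incoming minus
outgoing degrees, which subdivision preserves. If a balanced graph is the union of two balanced
ones, the factor carrying the difference vanishes. If the two pieces are unbalanced, their
imbalances are opposite and nonzero, so their spans meet nontrivially and a factor `1 / N` is gained
(`forestRank_add_lt`). Thus mere boundedness on non-Eulerian graphs suffices
(`BalancedVanishing.treeTerm_of_mul`). -/

theorem continuous_pderiv {σ R : Type*} [CommRing R] [TopologicalSpace R] [IsTopologicalRing R]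
    (x : σ) : Continuous fun f : MvPowerSeries σ R => pderiv R x f := by
  refine continuous_pi fun d => ?_
  have : (fun f : MvPowerSeries σ R => pderiv R x f d) =
      fun f => coeff (d + Finsupp.single x 1) f * ((d x : R) + 1) := by
    funext f
    exact coeff_pderiv f d
  rw [this]
  exact (WithPiTopology.continuous_coeff R _).mul continuous_const

/-- Chain rule for the substitution of finitely many formal power series. -/
theorem pderiv_subst {σ τ R : Type*} [Fintype σ] [CommRing R] {a : σ → MvPowerSeries τ R}
    (ha : HasSubst a) (x : τ) (f : MvPowerSeries σ R) :
    pderiv R x (subst a f) = ∑ i, subst a (pderiv R i f) * pderiv R x (a i) := by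
  classical
  -- With discrete coefficients substitution is continuous and polynomials are dense, so it suffices
  -- to compare the two sides on polynomials.
  let : UniformSpace R := ⊥
  have : DiscreteUniformity R := ⟨rfl⟩
  have hs : Continuous (subst a : MvPowerSeries σ R → MvPowerSeries τ R) := continuous_subst ha
  have hcont1 : Continuous fun f : MvPowerSeries σ R => pderiv R x (subst a f) :=
    (continuous_pderiv x).comp hs
  have hcont2 : Continuous fun f : MvPowerSeries σ R =>
      ∑ i, subst a (pderiv R i f) * pderiv R x (a i) :=
    continuous_finsetSum _ fun i _ => (hs.comp (continuous_pderiv i)).mul continuous_const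
  refine congrFun ((WithPiTopology.denseRange_toMvPowerSeries (R := R)).equalizer
    hcont1 hcont2 ?_) f
  funext p
  simp only [Function.comp_apply, pderiv_coe, subst_coe]
  induction p using MvPolynomial.induction_on with
  | C r => simp [MvPowerSeries.algebraMap_apply]
  | add p q hp hq => simp only [map_add, hp, hq, add_mul, Finset.sum_add_distrib]
  | mul_X p i hp =>
    simp only [map_mul, MvPolynomial.aeval_X, Derivation.leibniz, hp, smul_eq_mul, map_add,
      MvPolynomial.pderiv_X, Finset.mul_sum, add_mul, Finset.sum_add_distrib]
    congr 1
    · rw [Finset.sum_eq_single i]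
      · simp
      · intro j _ hj
        simp [hj.symm]
      · simp
    · exact Finset.sum_congr rfl fun j _ => by ring

end ChainRule

section Flow

open MvPowerSeries

variable {N : ℕ}

/-- The substituted value of `J i j`. -/
def sourceValue (N n : ℕ) (p : Fin N × Fin N) : RepSeries N n :=
  C (((Real.sqrt N)⁻¹ : ℝ) : ℂ) * gram n p.1 p.2

theorem hasSubst_sourceValue (N n : ℕ) : HasSubst (sourceValue N n) := by
  refine hasSubst_of_constantCoeff_zero fun p => ?_
  simp [sourceValue, gram]

/-- `barePotential` as an algebra homomorphism. -/
def bareHom (N n : ℕ) : SourceSeries N →ₐ[ℂ] RepSeries N n :=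
  substAlgHom (hasSubst_sourceValue N n)

theorem barePotential_eq (n : ℕ) (K : SourceSeries N) : barePotential n K = bareHom N n K := by
  rw [bareHom, substAlgHom_apply]
  rfl

theorem bareHom_C (n : ℕ) (z : ℂ) : bareHom N n (C z) = C z :=
  (bareHom N n).commutes z

theorem bareHom_X (n : ℕ) (p : Fin N × Fin N) : bareHom N n (X p) = sourceValue N n p :=
  substAlgHom_X (hasSubst_sourceValue N n) p

theorem pderiv_inl_sourceValue (n : ℕ) (j : Fin N) (a : Fin n) (p : Fin N × Fin N) :
    pderiv ℂ (Sum.inl (j, a)) (sourceValue N n p) =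
      if p.1 = j then C (((Real.sqrt N)⁻¹ : ℝ) : ℂ) * X (Sum.inr (p.2, a)) else 0 := by
  classical
  simp only [sourceValue, gram, Derivation.leibniz, pderiv_C, map_sum, pderiv_X, smul_eq_mul]
  split_ifs with h
  · subst h
    simp [Pi.single_apply]
  · simp [h]

theorem pderiv_inr_sourceValue (n : ℕ) (j : Fin N) (a : Fin n) (p : Fin N × Fin N) :
    pderiv ℂ (Sum.inr (j, a)) (sourceValue N n p) =
      if p.2 = j then C (((Real.sqrt N)⁻¹ : ℝ) : ℂ) * X (Sum.inl (p.1, a)) else 0 := by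
  classical
  simp only [sourceValue, gram, Derivation.leibniz, pderiv_C, map_sum, pderiv_X, smul_eq_mul]
  split_ifs with h
  · subst h
    simp [Pi.single_apply]
  · simp [h]

theorem pderiv_inl_bareHom (n : ℕ) (j : Fin N) (a : Fin n) (f : SourceSeries N) :
    pderiv ℂ (Sum.inl (j, a)) (bareHom N n f) =
      C (((Real.sqrt N)⁻¹ : ℝ) : ℂ) *
        ∑ l, bareHom N n (pderiv ℂ (j, l) f) * X (Sum.inr (l, a)) := by
  have h := pderiv_subst (hasSubst_sourceValue N n) (Sum.inl (j, a)) f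
  simp only [← substAlgHom_apply (hasSubst_sourceValue N n)] at h
  change pderiv ℂ (Sum.inl (j, a)) (bareHom N n f) = ∑ i, bareHom N n _ * _ at h
  rw [h, Fintype.sum_prod_type, Finset.sum_eq_single j]
  · rw [Finset.mul_sum]
    refine Finset.sum_congr rfl fun l _ => ?_
    rw [pderiv_inl_sourceValue, if_pos rfl]
    ring
  · intro i _ hi
    refine Finset.sum_eq_zero fun l _ => ?_
    rw [pderiv_inl_sourceValue, if_neg hi, mul_zero]
  · simp

theorem pderiv_inr_bareHom (n : ℕ) (j : Fin N) (a : Fin n) (f : SourceSeries N) :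
    pderiv ℂ (Sum.inr (j, a)) (bareHom N n f) =
      C (((Real.sqrt N)⁻¹ : ℝ) : ℂ) *
        ∑ i, bareHom N n (pderiv ℂ (i, j) f) * X (Sum.inl (i, a)) := by
  have h := pderiv_subst (hasSubst_sourceValue N n) (Sum.inr (j, a)) f
  simp only [← substAlgHom_apply (hasSubst_sourceValue N n)] at h
  change pderiv ℂ (Sum.inr (j, a)) (bareHom N n f) = ∑ i, bareHom N n _ * _ at h
  rw [h, Fintype.sum_prod_type_right, Finset.sum_eq_single j]
  · rw [Finset.mul_sum]
    refine Finset.sum_congr rfl fun l _ => ?_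
    rw [pderiv_inr_sourceValue, if_pos rfl]
    ring
  · intro i _ hi
    refine Finset.sum_eq_zero fun l _ => ?_
    rw [pderiv_inr_sourceValue, if_neg hi, mul_zero]
  · simp

/-- The part of the flow proportional to the number of replicas. -/
def replicaTerm (f : SourceSeries N) : SourceSeries N :=
  C (((Real.sqrt N)⁻¹ : ℝ) : ℂ) * ∑ j, pderiv ℂ (j, j) f

/-- The part of the flow that adds a loop. -/
def loopTerm (f : SourceSeries N) : SourceSeries N :=
  C (((Real.sqrt N)⁻¹ : ℝ) : ℂ) *
    ∑ i, ∑ l, ∑ j, X (i, l) * pderiv ℂ (j, l) (pderiv ℂ (i, j) f)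

/-- The part of the flow that joins two trees. -/
def treeTerm (f g : SourceSeries N) : SourceSeries N :=
  C (((Real.sqrt N)⁻¹ : ℝ) : ℂ) *
    ∑ i, ∑ l, ∑ j, X (i, l) * (pderiv ℂ (j, l) f * pderiv ℂ (i, j) g)

theorem sum_rotate {A B D E : Type*} [Fintype A] [Fintype B] [Fintype D] [AddCommMonoid E]
    (F : A → B → D → E) : ∑ a, ∑ b, ∑ d, F a b d = ∑ d, ∑ a, ∑ b, F a b d := by
  rw [Finset.sum_congr rfl fun a _ => Finset.sum_comm, Finset.sum_comm]

/-- The two derivatives leave factors `X̄` and `X` with the same replica index. Their sum over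
replicas is a Gram entry, which absorbs one of the two factors `1 / √N`. -/
theorem sum_pderiv_mul_bareHom (n : ℕ) (f g : SourceSeries N) :
    ∑ p : Fin N × Fin n, pderiv ℂ (Sum.inl p) (bareHom N n f) *
      pderiv ℂ (Sum.inr p) (bareHom N n g) = bareHom N n (treeTerm f g) := by
  rw [treeTerm, sum_rotate]
  simp only [map_mul, map_sum, bareHom_C, bareHom_X, sourceValue, gram,
    Fintype.sum_prod_type, pderiv_inl_bareHom, pderiv_inr_bareHom]
  rw [Finset.mul_sum]
  refine Finset.sum_congr rfl fun j _ => ?_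
  simp only [Finset.mul_sum, Finset.sum_mul]
  rw [← sum_rotate]
  refine Finset.sum_congr rfl fun i _ => Finset.sum_congr rfl fun l _ =>
    Finset.sum_congr rfl fun a _ => by ring

/-- The outer derivative acts either on the explicit factor `X` left by the inner one, where the
free sum over replicas gives `n`, or on `f` again, which closes a loop. -/
theorem sum_pderiv_pderiv_bareHom (n : ℕ) (f : SourceSeries N) :
    ∑ p : Fin N × Fin n, pderiv ℂ (Sum.inl p) (pderiv ℂ (Sum.inr p) (bareHom N n f)) =
      bareHom N n (C (n : ℂ) * replicaTerm f + loopTerm f) := by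
  classical
  rw [loopTerm, sum_rotate]
  simp only [replicaTerm, map_add, map_mul, map_sum, bareHom_C, bareHom_X, sourceValue,
    gram, Fintype.sum_prod_type, pderiv_inl_bareHom, pderiv_inr_bareHom, Derivation.leibniz,
    pderiv_C, smul_eq_mul, mul_zero, add_zero, pderiv_X, Finset.mul_sum, mul_add,
    Finset.sum_add_distrib]
  congr 1
  · refine Finset.sum_congr rfl fun j _ => ?_
    trans ∑ a : Fin n, C (((Real.sqrt N)⁻¹ : ℝ) : ℂ) * bareHom N n (pderiv ℂ (j, j) f)
    · refine Finset.sum_congr rfl fun a _ => ?_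
      rw [Finset.sum_eq_single j]
      · simp
      · intro i _ hi
        simp [hi]
      · simp
    · simp
  · refine Finset.sum_congr rfl fun j _ => ?_
    simp only [Finset.sum_mul, Finset.mul_sum]
    rw [← sum_rotate]
    refine Finset.sum_congr rfl fun i _ => Finset.sum_congr rfl fun l _ =>
      Finset.sum_congr rfl fun a _ => by ring

/-- The coefficients in powers of `t` of the flow started at `K`, for an arbitrary complex value
`z` of the number of replicas. -/
def flowCoeff (z : ℂ) (K : SourceSeries N) : ℕ → SourceSeries N
  | 0 => K
  | k + 1 => C ((k + 1 : ℂ)⁻¹) * (C z * replicaTerm (flowCoeff z K k) + loopTerm (flowCoeff z K k) +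
      ∑ m : Fin (k + 1), treeTerm (flowCoeff z K m) (flowCoeff z K (k - m)))
  termination_by k => k
  decreasing_by all_goals omega

/-- This moves the flow to a space independent of `n`, where the number of replicas is a parameter
that can be set to 0. -/
theorem effCoeff_barePotential (n : ℕ) (K : SourceSeries N) (k : ℕ) :
    effCoeff (barePotential n K) k = bareHom N n (flowCoeff n K k) := by
  induction k using Nat.strong_induction_on with
  | _ k ih =>
    cases k with
    | zero => rw [effCoeff, flowCoeff, barePotential_eq]
    | succ k =>
      rw [effCoeff, flowCoeff, map_mul, bareHom_C, Finset.sum_add_distrib, ih k (by omega),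
        sum_pderiv_pderiv_bareHom, Finset.sum_comm, map_add _ (_ + _), map_sum]
      congr 2
      refine Finset.sum_congr rfl fun m _ => ?_
      rw [ih m (by omega), ih (k - m) (by omega), sum_pderiv_mul_bareHom]

end Flow

/-! ### Polynomial dependence on the number of replicas -/

section PolynomialDependence

open MvPowerSeries

/-- All coefficients of a family of power series are polynomials in the parameter. -/
def DependsPolynomially {σ : Type*} (F : ℂ → MvPowerSeries σ ℂ) : Prop :=
  ∀ d, ∃ p : Polynomial ℂ, ∀ z, coeff d (F z) = p.eval z

variable {σ : Type*} {F F' : ℂ → MvPowerSeries σ ℂ}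

theorem DependsPolynomially.const (f : MvPowerSeries σ ℂ) : DependsPolynomially fun _ => f :=
  fun d => ⟨Polynomial.C (coeff d f), fun _ => by simp⟩

theorem DependsPolynomially.C_id :
    DependsPolynomially fun z => (C z : MvPowerSeries σ ℂ) := by
  classical
  intro d
  by_cases h : d = 0
  · exact ⟨Polynomial.X, fun z => by simp [h]⟩
  · exact ⟨0, fun z => by simp [coeff_C, h]⟩

theorem DependsPolynomially.add (h : DependsPolynomially F) (h' : DependsPolynomially F') :
    DependsPolynomially fun z => F z + F' z := by
  intro d
  obtain ⟨p, hp⟩ := h d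
  obtain ⟨q, hq⟩ := h' d
  exact ⟨p + q, fun z => by simp [hp, hq]⟩

theorem DependsPolynomially.sum {ι : Type*} (s : Finset ι) {F : ι → ℂ → MvPowerSeries σ ℂ}
    (h : ∀ i ∈ s, DependsPolynomially (F i)) : DependsPolynomially fun z => ∑ i ∈ s, F i z := by
  classical
  induction s using Finset.induction_on with
  | empty => simpa using DependsPolynomially.const 0
  | insert i s hi ih =>
    simp only [Finset.sum_insert hi]
    exact (h i (by simp)).add (ih fun j hj => h j (by simp [hj]))

theorem DependsPolynomially.mul (h : DependsPolynomially F) (h' : DependsPolynomially F') :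
    DependsPolynomially fun z => F z * F' z := by
  classical
  intro d
  choose p hp using h
  choose q hq using h'
  refine ⟨∑ x ∈ Finset.HasAntidiagonal.antidiagonal d, p x.1 * q x.2, fun z => ?_⟩
  simp [coeff_mul, hp, hq, Polynomial.eval_finsetSum]

theorem DependsPolynomially.pderiv (x : σ) (h : DependsPolynomially F) :
    DependsPolynomially fun z => MvPowerSeries.pderiv ℂ x (F z) := by
  intro d
  obtain ⟨p, hp⟩ := h (d + Finsupp.single x 1)
  refine ⟨p * Polynomial.C ((d x : ℂ) + 1), fun z => ?_⟩
  simp [coeff_pderiv, hp]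

theorem dependsPolynomially_flowCoeff {N : ℕ} (K : SourceSeries N) (k : ℕ) :
    DependsPolynomially fun z => flowCoeff z K k := by
  induction k using Nat.strong_induction_on with
  | _ k ih =>
    cases k with
    | zero =>
      simp only [flowCoeff]
      exact .const K
    | succ k =>
      simp only [flowCoeff]
      refine .mul (.const _) (.add (.add (.mul .C_id (.mul (.const _) (.sum _ fun j _ => ?_)))
        (.mul (.const _) (.sum _ fun i _ => .sum _ fun l _ => .sum _ fun j _ =>
          .mul (.const _) ?_)))
        (.sum _ fun m _ => .mul (.const _) (.sum _ fun i _ => .sum _ fun l _ => .sum _ fun j _ =>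
          .mul (.const _) (.mul ?_ ?_))))
      · exact (ih k (by omega)).pderiv _
      · exact ((ih k (by omega)).pderiv _).pderiv _
      · exact (ih m (by omega)).pderiv _
      · exact (ih (k - m) (by omega)).pderiv _

end PolynomialDependence

/-! ### Graphs with indices on the vertices and monomials -/

namespace OrientedGraph

variable {N : ℕ}

/-- The position of the matrix element attached to an edge. -/
def edgePair (G : OrientedGraph) (i : Fin G.v ↪ Fin N) (a : Fin G.e) : Fin N × Fin N :=
  (i (G.tgt a), i (G.src a))

theorem edgeExponent_apply (G : OrientedGraph) (i : Fin G.v ↪ Fin N) (p : Fin N × Fin N) :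
    edgeExponent G i p = Fintype.card {a // G.edgePair i a = p} := by
  classical
  rw [Fintype.card_subtype]
  simp only [edgeExponent, Finsupp.coe_finsetSum, Finset.sum_apply, Finsupp.single_apply,
    edgePair, Finset.sum_boole, Nat.cast_id]
  congr

theorem degree_edgeExponent (G : OrientedGraph) (i : Fin G.v ↪ Fin N) :
    (edgeExponent G i).degree = G.e := by
  simp [edgeExponent, map_sum]

theorem Iso.edgePair {G H : OrientedGraph} (φ : G.Iso H) (i : Fin H.v ↪ Fin N) (a : Fin G.e) :
    H.edgePair i (φ.onE a) = G.edgePair (φ.onV.toEmbedding.trans i) a := by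
  simp [OrientedGraph.edgePair, φ.src_comm, φ.tgt_comm]

theorem Iso.edgeExponent {G H : OrientedGraph} (φ : G.Iso H) (i : Fin H.v ↪ Fin N) :
    edgeExponent G (φ.onV.toEmbedding.trans i) = ReplicaWigner.edgeExponent H i := by
  ext p
  rw [edgeExponent_apply, edgeExponent_apply]
  refine Fintype.card_congr (φ.onE.subtypeEquiv fun a => ?_)
  rw [φ.edgePair]

theorem mem_range_iff (G : OrientedGraph) (i : Fin G.v ↪ Fin N) (x : Fin N) :
    x ∈ Set.range i ↔ ∃ a, (G.edgePair i a).1 = x ∨ (G.edgePair i a).2 = x := by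
  constructor
  · rintro ⟨y, rfl⟩
    obtain ⟨a, h | h⟩ := G.no_isolated y
    · exact ⟨a, Or.inr (by simp [edgePair, h])⟩
    · exact ⟨a, Or.inl (by simp [edgePair, h])⟩
  · rintro ⟨a, rfl | rfl⟩
    · exact ⟨_, rfl⟩
    · exact ⟨_, rfl⟩

/-- A bijection of the edges that preserves the indices of their ends extends to an
isomorphism. -/
theorem exists_iso_of_edges {G H : OrientedGraph} (i : Fin G.v ↪ Fin N) (j : Fin H.v ↪ Fin N)
    (ε : Fin G.e ≃ Fin H.e) (hε : ∀ a, H.edgePair j (ε a) = G.edgePair i a) :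
    ∃ φ : G.Iso H, φ.onE = ε ∧ φ.onV.toEmbedding.trans j = i := by
  have hr : Set.range i = Set.range j := by
    ext x
    rw [mem_range_iff, mem_range_iff]
    constructor
    · rintro ⟨a, ha⟩
      exact ⟨ε a, by rwa [hε]⟩
    · rintro ⟨a, ha⟩
      exact ⟨ε.symm a, by rwa [← hε, ε.apply_symm_apply]⟩
  let σ : Fin G.v ≃ Fin H.v := (Equiv.ofInjective i i.injective).trans
    ((Equiv.setCongr hr).trans (Equiv.ofInjective j j.injective).symm)
  have hσ : ∀ x, j (σ x) = i x := by
    intro x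
    simp only [σ, Equiv.trans_apply]
    rw [Equiv.apply_ofInjective_symm j.injective]
    rfl
  refine ⟨⟨σ, ε, fun a => j.injective ?_, fun a => j.injective ?_⟩, rfl, ?_⟩
  · rw [hσ]
    exact congrArg Prod.snd (hε a)
  · rw [hσ]
    exact congrArg Prod.fst (hε a)
  · ext x
    simp [hσ]

theorem exists_edge_equiv {G H : OrientedGraph} {i : Fin G.v ↪ Fin N} {j : Fin H.v ↪ Fin N}
    (h : edgeExponent G i = edgeExponent H j) :
    ∃ ε : Fin G.e ≃ Fin H.e, ∀ a, H.edgePair j (ε a) = G.edgePair i a := by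
  have hc : ∀ p, Nonempty ({a // G.edgePair i a = p} ≃ {a // H.edgePair j a = p}) := fun p => by
    rw [← Fintype.card_eq, ← edgeExponent_apply, ← edgeExponent_apply, h]
  exact ⟨Equiv.ofFiberEquiv fun p => (hc p).some, Equiv.ofFiberEquiv_map _⟩

/-- The edge multiplicities determine the graph with its indices up to isomorphism. -/
theorem exists_iso_of_edgeExponent_eq {G H : OrientedGraph} {i : Fin G.v ↪ Fin N}
    {j : Fin H.v ↪ Fin N} (h : edgeExponent G i = edgeExponent H j) :
    ∃ φ : G.Iso H, φ.onV.toEmbedding.trans j = i := by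
  obtain ⟨ε, hε⟩ := exists_edge_equiv h
  obtain ⟨φ, -, hφ⟩ := exists_iso_of_edges i j ε hε
  exact ⟨φ, hφ⟩

theorem Iso.ext_iff' {G H : OrientedGraph} {φ ψ : G.Iso H} :
    φ = ψ ↔ φ.onV = ψ.onV ∧ φ.onE = ψ.onE := by
  constructor
  · rintro rfl
    exact ⟨rfl, rfl⟩
  · cases φ
    cases ψ
    rintro ⟨rfl, rfl⟩
    rfl

instance (G H : OrientedGraph) : Finite (G.Iso H) :=
  Finite.of_injective (fun φ => (φ.onV, φ.onE)) fun φ ψ h => by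
    rw [Iso.ext_iff']
    simpa using h

theorem cardAut_ne_zero (G : OrientedGraph) : G.cardAut ≠ 0 := by
  have : Nonempty (G.Iso G) := ⟨Iso.refl G⟩
  exact Nat.card_pos.ne'

/-- The number of edge bijections above a given relabelling of the vertices. -/
theorem card_edge_equiv (G : OrientedGraph) {i j : Fin G.v ↪ Fin N}
    (h : edgeExponent G i = edgeExponent G j) :
    Nat.card {ε : Equiv.Perm (Fin G.e) // ∀ a, G.edgePair j (ε a) = G.edgePair i a} =
      ∏ p, (edgeExponent G j p).factorial := by
  classical
  obtain ⟨ε₀, h₀⟩ := exists_edge_equiv h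
  -- The bijections form a torsor: composing with the inverse of `ε₀` identifies them with the
  -- stabilizer of `edgePair j`, which permutes parallel edges.
  have e : {ε : Equiv.Perm (Fin G.e) // ∀ a, G.edgePair j (ε a) = G.edgePair i a} ≃
      {ε : Equiv.Perm (Fin G.e) // G.edgePair j ∘ ε = G.edgePair j} :=
    (Equiv.mulRight ε₀⁻¹).subtypeEquiv fun ε => by
      simp only [Equiv.coe_mulRight, funext_iff, Function.comp_apply, Equiv.Perm.mul_apply]
      rw [← ε₀.forall_congr_right (q := fun a => _ = G.edgePair j a)]
      simp [h₀]
  rw [Nat.card_congr e, Nat.card_eq_fintype_card, DomMulAct.stabilizer_card]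
  simp only [edgeExponent_apply]

/-- An automorphism is the same thing as a labeling with the multiplicities of `j` together with a
bijection of the edges above it. This is what makes `1 / |Aut G|` the right weight. -/
theorem card_labelings (G : OrientedGraph) (j : Fin G.v ↪ Fin N) :
    Nat.card {i : Fin G.v ↪ Fin N // edgeExponent G i = edgeExponent G j} *
      ∏ p, (edgeExponent G j p).factorial = G.cardAut := by
  classical
  let f : (Σ i : {i : Fin G.v ↪ Fin N // edgeExponent G i = edgeExponent G j},
      {ε : Equiv.Perm (Fin G.e) // ∀ a, G.edgePair j (ε a) = G.edgePair i.1 a}) → G.Iso G :=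
    fun x => (exists_iso_of_edges x.1.1 j x.2.1 x.2.2).choose
  have hf : ∀ x, (f x).onE = x.2.1 ∧ (f x).onV.toEmbedding.trans j = x.1.1 := fun x =>
    (exists_iso_of_edges x.1.1 j x.2.1 x.2.2).choose_spec
  have hbij : Function.Bijective f := by
    constructor
    · rintro ⟨⟨i, hi⟩, ⟨ε, hε⟩⟩ ⟨⟨i', hi'⟩, ⟨ε', hε'⟩⟩ h
      have h1 := hf ⟨⟨i, hi⟩, ⟨ε, hε⟩⟩
      have h2 := hf ⟨⟨i', hi'⟩, ⟨ε', hε'⟩⟩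
      rw [h] at h1
      obtain rfl : i = i' := h1.2.symm.trans h2.2
      obtain rfl : ε = ε' := h1.1.symm.trans h2.1
      rfl
    · intro φ
      refine ⟨⟨⟨φ.onV.toEmbedding.trans j, φ.edgeExponent j⟩, ⟨φ.onE, φ.edgePair j⟩⟩, ?_⟩
      obtain ⟨h1, h2⟩ := hf ⟨⟨φ.onV.toEmbedding.trans j, φ.edgeExponent j⟩,
        ⟨φ.onE, φ.edgePair j⟩⟩
      rw [Iso.ext_iff']
      refine ⟨?_, h1⟩
      ext x
      have := congrArg (fun e : Fin G.v ↪ Fin N => e x) h2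
      exact congrArg Fin.val (by simpa using this)
  rw [cardAut, ← Nat.card_congr (Equiv.ofBijective f hbij), Nat.card_sigma,
    Finset.sum_congr rfl fun i _ => G.card_edge_equiv i.2, Finset.sum_const, smul_eq_mul,
    Finset.card_univ, Nat.card_eq_fintype_card]

/-- Take `d p` copies of each position `p` as edges, and as vertices only the indices that occur in
them, so that none is isolated. -/
theorem exists_edgeExponent_eq (d : Fin N × Fin N →₀ ℕ) :
    ∃ (G : OrientedGraph) (i : Fin G.v ↪ Fin N), edgeExponent G i = d := by
  classical
  let E := Σ p : Fin N × Fin N, Fin (d p)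
  let V := {x : Fin N // ∃ a : E, a.1.1 = x ∨ a.1.2 = x}
  let eE := Fintype.equivFin E
  let eV := Fintype.equivFin V
  let G : OrientedGraph :=
    { v := Fintype.card V
      e := Fintype.card E
      src := fun a => eV ⟨(eE.symm a).1.2, ⟨_, Or.inr rfl⟩⟩
      tgt := fun a => eV ⟨(eE.symm a).1.1, ⟨_, Or.inl rfl⟩⟩
      no_isolated := fun x => by
        obtain ⟨y, rfl⟩ := eV.surjective x
        obtain ⟨y, a, ha⟩ := y
        refine ⟨eE a, ?_⟩
        rcases ha with rfl | rfl
        · exact Or.inr (by simp)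
        · exact Or.inl (by simp) }
  let i : Fin G.v ↪ Fin N := eV.symm.toEmbedding.trans (Function.Embedding.subtype _)
  have hp : ∀ a, G.edgePair i a = (eE.symm a).1 := fun a => by
    refine Prod.ext ?_ ?_
    · change (eV.symm (eV _)).1 = _
      rw [eV.symm_apply_apply]
    · change (eV.symm (eV _)).1 = _
      rw [eV.symm_apply_apply]
  refine ⟨G, i, ?_⟩
  ext p
  rw [edgeExponent_apply]
  have e : {a // G.edgePair i a = p} ≃ Fin (d p) :=
    (eE.symm.subtypeEquiv fun a => by rw [hp a]).trans (Equiv.sigmaSubtype p)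
  rw [Fintype.card_congr e, Fintype.card_fin]

end OrientedGraph

/-! ### Graph expansions and power series in the source -/

section Expansion

open MvPowerSeries

variable {N : ℕ}

/-- The finite set is independent of `f`. One set then serves all graphs at once and reduces the sum
over graphs to finitely many exponents. -/
theorem coeff_bareHom (n : ℕ) (m : RepVar N n →₀ ℕ) :
    ∃ D : Finset (Fin N × Fin N →₀ ℕ), ∀ f : SourceSeries N,
      coeff m (bareHom N n f) =
        ∑ d ∈ D, coeff d f * coeff m (bareHom N n (monomial d 1)) := by
  have hs := hasSubst_sourceValue N n
  have hmon : ∀ d, bareHom N n (monomial d 1) = d.prod fun s e => sourceValue N n s ^ e := by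
    intro d
    rw [bareHom, substAlgHom_monomial]
    simp
  have hfin : {d | coeff m (bareHom N n (monomial d 1)) ≠ 0}.Finite := by
    -- The series with all coefficients 1 detects every exponent that can contribute.
    refine (coeff_subst_finite hs (fun _ => (1 : ℂ) : SourceSeries N) m).subset fun d hd => ?_
    rw [Set.mem_ofPred_eq, hmon] at hd
    rw [Function.mem_support]
    have h1 : coeff d (fun _ => (1 : ℂ) : SourceSeries N) = 1 := rfl
    rwa [h1, one_smul]
  refine ⟨hfin.toFinset, fun f => ?_⟩
  have := coeff_subst hs f m
  rw [← substAlgHom_apply hs] at this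
  change coeff m (bareHom N n f) = _ at this
  rw [this, finsum_eq_sum_of_support_subset (s := hfin.toFinset)]
  · exact Finset.sum_congr rfl fun d _ => by rw [hmon, smul_eq_mul]
  · intro d hd
    simp only [Set.Finite.coe_toFinset, Set.mem_ofPred_eq, hmon]
    exact right_ne_zero_of_smul hd

/-- The coefficients are invariant under isomorphisms. -/
def GraphCoeff.Invariant (C : GraphCoeff N) : Prop :=
  ∀ (G H : OrientedGraph) (φ : G.Iso H) (i : Fin H.v ↪ Fin N),
    C G (φ.onV.toEmbedding.trans i) = C H i

theorem GraphCoeff.Invariant.congr {C : GraphCoeff N} (hC : C.Invariant) {G H : OrientedGraph}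
    {i : Fin G.v ↪ Fin N} {j : Fin H.v ↪ Fin N} (h : edgeExponent G i = edgeExponent H j) :
    C G i = C H j := by
  obtain ⟨φ, rfl⟩ := OrientedGraph.exists_iso_of_edgeExponent_eq h
  exact hC G H φ j


theorem monomial_edgeExponent (G : OrientedGraph) (i : Fin G.v ↪ Fin N) :
    (monomial (edgeExponent G i) 1 : SourceSeries N) = ∏ a, X (i (G.tgt a), i (G.src a)) := by
  simp only [edgeExponent, X]
  exact Finset.induction_on (motive := fun s => (monomial (∑ a ∈ s,
    Finsupp.single (i (G.tgt a), i (G.src a)) 1) 1 : SourceSeries N) =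
      ∏ a ∈ s, monomial (Finsupp.single (i (G.tgt a), i (G.src a)) 1) 1) Finset.univ (by simp)
    fun a s ha ih => by
      rw [Finset.sum_insert ha, Finset.prod_insert ha, ← ih, monomial_mul_monomial, one_mul]

/-- The prefactor `N ^ (-e / 2)` is exactly what the `e` substituted entries `X X† / √N` produce. -/
theorem graphTerm_eq_bareHom (n : ℕ) (C₀ : GraphCoeff N) (G : OrientedGraph) :
    graphTerm n C₀ G = bareHom N n (∑ i : Fin G.v ↪ Fin N,
      monomial (edgeExponent G i) ((C₀ G i).eval (n : ℂ) / G.cardAut)) := by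
  rw [graphTerm, Finset.mul_sum, map_sum]
  refine Finset.sum_congr rfl fun i _ => ?_
  have h1 : (monomial (edgeExponent G i) ((C₀ G i).eval (n : ℂ) / G.cardAut) : SourceSeries N) =
      C ((C₀ G i).eval (n : ℂ) / G.cardAut) * monomial (edgeExponent G i) 1 := by
    rw [← monomial_zero_eq_C_apply, monomial_mul_monomial, zero_add, mul_one]
  have h2 : ((N : ℝ) ^ ((G.e : ℝ) / 2)) = Real.sqrt N ^ G.e := by
    rw [Real.rpow_div_two_eq_sqrt _ (Nat.cast_nonneg N), Real.rpow_natCast]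
  rw [h1, map_mul, bareHom_C, monomial_edgeExponent, map_prod]
  simp only [bareHom_X, sourceValue, Finset.prod_mul_distrib, Finset.prod_const, Finset.card_univ,
    Fintype.card_fin]
  rw [← map_pow, ← mul_assoc, ← mul_assoc, ← map_mul, ← map_mul, h2]
  congr 2
  push_cast
  rw [mul_inv, inv_pow]
  ring

theorem graphCumulant_congr (K : SourceSeries N) {G H : OrientedGraph} {i : Fin G.v ↪ Fin N}
    {j : Fin H.v ↪ Fin N} (h : edgeExponent G i = edgeExponent H j) :
    graphCumulant K G i = graphCumulant K H j := by
  rw [graphCumulant, graphCumulant, h]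

theorem prod_factorial_ne_zero (d : Fin N × Fin N →₀ ℕ) :
    (∏ p : Fin N × Fin N, ((d p).factorial : ℂ)) ≠ 0 :=
  Finset.prod_ne_zero_iff.mpr fun p _ => by exact_mod_cast (d p).factorial_ne_zero

/-- The coefficients of the source polynomial of a graph. -/
theorem coeff_sum_monomial (f : SourceSeries N) {G : OrientedGraph} (z : (Fin G.v ↪ Fin N) → ℂ)
    (hz : ∀ i, graphCumulant f G i = z i) (d : Fin N × Fin N →₀ ℕ) :
    coeff d (∑ i : Fin G.v ↪ Fin N, monomial (edgeExponent G i) (z i / G.cardAut) :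
      SourceSeries N) =
        if ∃ j : Fin G.v ↪ Fin N, edgeExponent G j = d then coeff d f else 0 := by
  classical
  simp only [map_sum, coeff_monomial]
  split_ifs with h
  · obtain ⟨j, rfl⟩ := h
    have h1 : ∀ i : Fin G.v ↪ Fin N,
        (if edgeExponent G j = edgeExponent G i then z i / G.cardAut else 0) =
          if edgeExponent G i = edgeExponent G j then z j / G.cardAut else 0 := by
      intro i
      by_cases hij : edgeExponent G i = edgeExponent G j
      · rw [if_pos hij, if_pos hij.symm, ← hz, ← hz, graphCumulant_congr f hij]
      · rw [if_neg hij, if_neg (Ne.symm hij)]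
    rw [Finset.sum_congr rfl fun i _ => h1 i, ← Finset.sum_filter, Finset.sum_const, nsmul_eq_mul,
      ← Fintype.card_subtype, ← hz, graphCumulant]
    -- The labelings with the same exponent, times the factorials in the cumulant, cancel `1 / |Aut
    -- G|`.
    have h2 := congrArg (Nat.cast (R := ℂ)) (G.card_labelings j)
    rw [Nat.card_eq_fintype_card] at h2
    push_cast at h2
    have h3 : (G.cardAut : ℂ) ≠ 0 := by exact_mod_cast G.cardAut_ne_zero
    rw [mul_div_assoc', ← mul_assoc, h2, mul_div_cancel_left₀ _ h3]
  · refine Finset.sum_eq_zero fun i _ => if_neg fun hi => h ⟨i, hi.symm⟩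

/-- A power series in the source, evaluated at `J = X X† / √N`, is a sum over graphs. -/
theorem hasSum_graphTerm (n : ℕ) (f : SourceSeries N) (C₀ : GraphCoeff N)
    (h : ∀ G i, graphCumulant f G i = (C₀ G i).eval (n : ℂ)) (m : RepVar N n →₀ ℕ) :
    HasSum (fun G : GraphClass => coeff m (graphTerm n C₀ G.out)) (coeff m (bareHom N n f)) := by
  classical
  obtain ⟨D, hD⟩ := coeff_bareHom n m (N := N)
  choose g i hg using OrientedGraph.exists_edgeExponent_eq (N := N)
  have hcls : ∀ (G : GraphClass) (d : Fin N × Fin N →₀ ℕ),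
      (∃ j : Fin G.out.v ↪ Fin N, edgeExponent G.out j = d) ↔ G = ⟦g d⟧ := by
    intro G d
    constructor
    · rintro ⟨j, hj⟩
      obtain ⟨φ, -⟩ := OrientedGraph.exists_iso_of_edgeExponent_eq (hj.trans (hg d).symm)
      rw [← G.out_eq]
      exact Quotient.sound ⟨φ⟩
    · rintro rfl
      obtain ⟨φ⟩ : Nonempty ((⟦g d⟧ : GraphClass).out.Iso (g d)) := Quotient.mk_out (g d)
      exact ⟨φ.onV.toEmbedding.trans (i d), (φ.edgeExponent (i d)).trans (hg d)⟩
  rw [hD]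
  -- Each exponent belongs to exactly one isomorphism class, so only finitely many classes
  -- contribute to the coefficient of `m`.
  have hterm : ∀ G : GraphClass, coeff m (graphTerm n C₀ G.out) =
      ∑ d ∈ D, (if G = ⟦g d⟧ then coeff d f * coeff m (bareHom N n (monomial d 1)) else 0) := by
    intro G
    rw [graphTerm_eq_bareHom, hD]
    refine Finset.sum_congr rfl fun d _ => ?_
    rw [coeff_sum_monomial f _ (h G.out), ite_mul, zero_mul]
    exact if_congr (hcls G d) rfl rfl
  simp only [hterm]
  exact hasSum_sum fun d _ => hasSum_ite_eq _ _

/-- The substitution that recovers the source from many replicas. -/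
def replicaSection (N n : ℕ) : RepVar N n → MvPowerSeries (Option (Fin N × Fin N)) ℂ
  | Sum.inl (i, a) => if h : a.1 < N then X (some (i, ⟨a.1, h⟩)) else 0
  | Sum.inr (j, a) => if a.1 = j.1 then X none else 0

theorem hasSubst_replicaSection (N n : ℕ) : HasSubst (replicaSection N n) := by
  refine hasSubst_of_constantCoeff_zero fun x => ?_
  rcases x with ⟨i, a⟩ | ⟨j, a⟩
  · simp only [replicaSection]
    split_ifs <;> simp
  · simp only [replicaSection]
    split_ifs <;> simp

/-- With at least `N` replicas, a power series in the source is determined by its value at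
`J = X X† / √N`. -/
theorem bareHom_injective {n : ℕ} (hN : 1 ≤ N) (hn : N ≤ n) :
    Function.Injective (bareHom N n) := by
  classical
  have hb := hasSubst_replicaSection N n
  set c : ℂ := (((Real.sqrt N)⁻¹ : ℝ) : ℂ) with hc
  have hc0 : c ≠ 0 := by
    rw [hc]
    have : (0 : ℝ) < Real.sqrt N := Real.sqrt_pos.mpr (by exact_mod_cast hN)
    exact_mod_cast (inv_pos.mpr this).ne'
  -- The first `N` replicas send `X i a` to a free variable and `X̄ j a` to `δ` times the extra
  -- variable `X none`. Thus `J i j` becomes `c` times a monomial from which the exponent can be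
  -- read off. The extra variable, in place of 1, keeps the constant terms zero, so that the
  -- substitution is legitimate.
  let u : Fin N × Fin N → Option (Fin N × Fin N) →₀ ℕ := fun p =>
    Finsupp.single (some p) 1 + Finsupp.single none 1
  have hs : ∀ p, substAlgHom hb (sourceValue N n p) = monomial (u p) c := by
    intro p
    have h1 : ∀ i j : Fin N, substAlgHom hb (gram n i j) = monomial (u (i, j)) 1 := by
      intro i j
      have hX : (monomial (u (i, j)) 1 : MvPowerSeries (Option (Fin N × Fin N)) ℂ) =
          X (some (i, j)) * X none := by
        rw [X, X, monomial_mul_monomial, one_mul]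
      rw [gram, map_sum, hX]
      simp only [map_mul, substAlgHom_X]
      rw [Finset.sum_eq_single (⟨j.1, j.2.trans_le hn⟩ : Fin n)]
      · simp [replicaSection]
      · intro a _ ha
        have : a.1 ≠ j.1 := fun h => ha (Fin.ext h)
        simp [replicaSection, this]
      · simp
    have h2 : substAlgHom hb (C c) = C c := (substAlgHom hb).commutes c
    rw [sourceValue, map_mul, h1, ← hc, h2, ← monomial_zero_eq_C_apply, monomial_mul_monomial,
      zero_add, mul_one]
  let U : (Fin N × Fin N →₀ ℕ) → Option (Fin N × Fin N) →₀ ℕ := fun d => ∑ p, d p • u p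
  have hU : Function.Injective U := by
    intro d d' h
    ext p
    have := DFunLike.congr_fun h (some p)
    simpa [U, u, Finsupp.single_apply] using this
  have hmon : ∀ d : Fin N × Fin N →₀ ℕ,
      (d.prod fun p e => substAlgHom hb (sourceValue N n p) ^ e) =
        monomial (U d) (∏ p, c ^ d p) := by
    intro d
    rw [Finsupp.prod_fintype _ _ fun p => pow_zero _, ← prod_monomial]
    refine Finset.prod_congr rfl fun p _ => ?_
    rw [hs, monomial_pow]
  have hcoeff : ∀ (f : SourceSeries N) (d : Fin N × Fin N →₀ ℕ),
      coeff (U d) (substAlgHom hb (bareHom N n f)) = coeff d f * ∏ p, c ^ d p := by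
    intro f d
    have ha := hasSubst_sourceValue N n
    rw [bareHom, substAlgHom_comp_substAlgHom_apply ha hb, substAlgHom_apply,
      coeff_subst (ha.comp hb), finsum_eq_single _ d]
    · rw [hmon, coeff_monomial_same, smul_eq_mul]
    · intro d' hd'
      rw [hmon, coeff_monomial_ne fun h => hd' (hU h).symm, smul_zero]
  intro f f' hff
  ext d
  have h1 := hcoeff f d
  rw [hff, hcoeff f' d] at h1
  exact (mul_right_cancel₀ (Finset.prod_ne_zero_iff.mpr fun p _ => pow_ne_zero _ hc0) h1).symm

/-- Invariance lets the candidate coefficients be reassembled into a source series. Injectivity of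
`bareHom` identifies it with `F n` for every `n ≥ N`, and polynomiality continues the identity to 0.
Order 0 is therefore well defined even though no single small `n` determines the coefficients. -/
theorem eq_of_isGraphExpansion (hN : 1 ≤ N) {F : ℂ → SourceSeries N}
    (hF : DependsPolynomially F) {V : (n : ℕ) → RepSeries N n}
    (hV : ∀ n : ℕ, V n = bareHom N n (F n)) {C₀ : GraphCoeff N} (hC : IsGraphExpansion V C₀)
    (G : OrientedGraph) (i : Fin G.v ↪ Fin N) :
    (C₀ G i).coeff 0 = graphCumulant (F 0) G i := by
  choose g j hg using OrientedGraph.exists_edgeExponent_eq (N := N)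
  have hinv : C₀.Invariant := hC.1
  let f : ℕ → SourceSeries N := fun n d =>
    (C₀ (g d) (j d)).eval (n : ℂ) / ∏ p : Fin N × Fin N, ((d p).factorial : ℂ)
  have hf : ∀ n G i, graphCumulant (f n) G i = (C₀ G i).eval (n : ℂ) := by
    intro n G i
    have h1 : coeff (edgeExponent G i) (f n) = (C₀ G i).eval (n : ℂ) /
        ∏ p : Fin N × Fin N, ((edgeExponent G i p).factorial : ℂ) := by
      change (C₀ (g _) (j _)).eval (n : ℂ) / _ = _
      rw [hinv.congr (hg (edgeExponent G i))]
    rw [graphCumulant, h1, mul_div_cancel₀ _ (prod_factorial_ne_zero _)]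
  have hbare : ∀ n, bareHom N n (f n) = bareHom N n (F n) := by
    intro n
    ext m
    rw [← hV]
    exact (hasSum_graphTerm n (f n) C₀ (hf n) m).unique (hC.2 n m)
  obtain ⟨q, hq⟩ := hF (edgeExponent G i)
  have hpoly : C₀ G i =
      Polynomial.C (∏ p : Fin N × Fin N, ((edgeExponent G i p).factorial : ℂ)) * q := by
    refine Polynomial.eq_of_infinite_eval_eq _ _ ?_
    refine Set.Infinite.mono (s := Nat.cast '' Set.Ici N) ?_
      ((Set.Ici_infinite N).image Nat.cast_injective.injOn)
    rintro _ ⟨n, hn, rfl⟩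
    rw [Set.mem_ofPred_eq, ← hf, bareHom_injective hN hn (hbare n), graphCumulant, hq,
      Polynomial.eval_mul, Polynomial.eval_C]
  rw [hpoly, Polynomial.coeff_zero_eq_eval_zero, Polynomial.eval_mul, Polynomial.eval_C, ← hq,
    graphCumulant]

theorem exists_isGraphExpansion {F : ℂ → SourceSeries N}
    (hF : DependsPolynomially F) {V : (n : ℕ) → RepSeries N n}
    (hV : ∀ n : ℕ, V n = bareHom N n (F n)) : ∃ C₀ : GraphCoeff N, IsGraphExpansion V C₀ := by
  choose q hq using hF
  refine ⟨fun G i => Polynomial.C (∏ p : Fin N × Fin N, ((edgeExponent G i p).factorial : ℂ)) *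
    q (edgeExponent G i), fun G H φ i => ?_, fun n m => ?_⟩
  · simp only [φ.edgeExponent]
  · rw [hV]
    refine hasSum_graphTerm n _ _ (fun G i => ?_) m
    rw [graphCumulant, hq, Polynomial.eval_mul, Polynomial.eval_C]

end Expansion

/-! ### The rank and the imbalance of a monomial -/

section Rank

variable {N : ℕ}

/-- The difference of the ends of an edge. -/
def edgeVector (p : Fin N × Fin N) : Fin N → ℚ := Pi.single p.1 1 - Pi.single p.2 1

/-- The span of the differences of the ends of the edges. -/
def edgeSpan (d : Fin N × Fin N →₀ ℕ) : Submodule ℚ (Fin N → ℚ) :=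
  Submodule.span ℚ (edgeVector '' (d.support : Set (Fin N × Fin N)))

/-- The number of edges of a spanning forest. -/
def forestRank (d : Fin N × Fin N →₀ ℕ) : ℕ := Module.finrank ℚ (edgeSpan d)

/-- Incoming minus outgoing edges at every vertex. -/
def imbalance (d : Fin N × Fin N →₀ ℕ) : Fin N → ℚ := ∑ p, (d p : ℚ) • edgeVector p

/-- The ends of the edges. -/
def ends (d : Fin N × Fin N →₀ ℕ) : Finset (Fin N) :=
  d.support.image Prod.fst ∪ d.support.image Prod.snd

theorem edgeVector_mem {d : Fin N × Fin N →₀ ℕ} {p : Fin N × Fin N} (h : d p ≠ 0) :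
    edgeVector p ∈ edgeSpan d :=
  Submodule.subset_span ⟨p, by simpa using h, rfl⟩

theorem edgeSpan_le {d : Fin N × Fin N →₀ ℕ} {W : Submodule ℚ (Fin N → ℚ)} :
    edgeSpan d ≤ W ↔ ∀ p, d p ≠ 0 → edgeVector p ∈ W := by
  rw [edgeSpan, Submodule.span_le]
  constructor
  · intro h p hp
    exact h ⟨p, by simpa using hp, rfl⟩
  · rintro h _ ⟨p, hp, rfl⟩
    exact h p (by simpa using hp)

theorem edgeSpan_add (d d' : Fin N × Fin N →₀ ℕ) :
    edgeSpan (d + d') = edgeSpan d ⊔ edgeSpan d' := by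
  apply le_antisymm
  · refine edgeSpan_le.mpr fun p hp => ?_
    by_cases h : d p = 0
    · refine Submodule.mem_sup_right (edgeVector_mem ?_)
      simpa [h] using hp
    · exact Submodule.mem_sup_left (edgeVector_mem h)
  · refine sup_le (edgeSpan_le.mpr fun p hp => edgeVector_mem ?_)
      (edgeSpan_le.mpr fun p hp => edgeVector_mem ?_)
    · simp [hp]
    · simp [hp]

theorem imbalance_add (d d' : Fin N × Fin N →₀ ℕ) :
    imbalance (d + d') = imbalance d + imbalance d' := by
  simp [imbalance, add_smul, Finset.sum_add_distrib]

theorem imbalance_single (p : Fin N × Fin N) :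
    imbalance (Finsupp.single p 1) = edgeVector p := by
  classical
  simp [imbalance, Finsupp.single_apply]

theorem edgeVector_add (i j l : Fin N) :
    edgeVector (i, j) + edgeVector (j, l) = edgeVector (i, l) := by
  simp [edgeVector]

theorem imbalance_mem (d : Fin N × Fin N →₀ ℕ) : imbalance d ∈ edgeSpan d := by
  refine Submodule.sum_mem _ fun p _ => ?_
  by_cases h : d p = 0
  · simp [h]
  · exact Submodule.smul_mem _ _ (edgeVector_mem h)

theorem forestRank_add_le (d d' : Fin N × Fin N →₀ ℕ) :
    forestRank (d + d') ≤ forestRank d + forestRank d' := by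
  rw [forestRank, edgeSpan_add]
  exact Submodule.finrank_add_le_finrank_add_finrank _ _

/-- Two unbalanced graphs whose union is balanced have a cycle in common. -/
theorem forestRank_add_lt {d d' : Fin N × Fin N →₀ ℕ} (h : imbalance (d + d') = 0)
    (hd : imbalance d ≠ 0) : forestRank (d + d') + 1 ≤ forestRank d + forestRank d' := by
  have h1 := Submodule.finrank_sup_add_finrank_inf_eq (edgeSpan d) (edgeSpan d')
  -- The imbalances are opposite, so one nonzero vector lies in both spans and the dimension formula
  -- loses at least one.
  have h2 : imbalance d ∈ edgeSpan d ⊓ edgeSpan d' := by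
    refine ⟨imbalance_mem d, ?_⟩
    rw [imbalance_add] at h
    rw [eq_neg_of_add_eq_zero_left h]
    exact Submodule.neg_mem _ (imbalance_mem d')
  have h3 : 0 < Module.finrank ℚ ↥(edgeSpan d ⊓ edgeSpan d') := by
    rw [Module.finrank_pos_iff]
    exact ⟨⟨⟨_, h2⟩, 0, fun h0 => hd (congrArg Subtype.val h0)⟩⟩
  rw [forestRank, edgeSpan_add, forestRank, forestRank]
  omega

/-- The vector of `i → l` is the sum of those of `i → j` and `j → l`. -/
theorem edgeSpan_le_subdivide (d : Fin N × Fin N →₀ ℕ) (i j l : Fin N) :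
    edgeSpan (d + Finsupp.single (i, l) 1) ≤
      edgeSpan (d + Finsupp.single (i, j) 1 + Finsupp.single (j, l) 1) := by
  rw [edgeSpan_add]
  refine sup_le ?_ (edgeSpan_le.mpr fun p hp => ?_)
  · rw [add_assoc, edgeSpan_add]
    exact le_sup_left
  · rw [Finsupp.single_apply] at hp
    split_ifs at hp with h
    · rw [← h, ← edgeVector_add i j l]
      exact Submodule.add_mem _ (edgeVector_mem (by simp)) (edgeVector_mem (by simp))
    · exact absurd rfl hp

theorem forestRank_le_subdivide (d : Fin N × Fin N →₀ ℕ) (i j l : Fin N) :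
    forestRank (d + Finsupp.single (i, l) 1) ≤
      forestRank (d + Finsupp.single (i, j) 1 + Finsupp.single (j, l) 1) :=
  Submodule.finrank_mono (edgeSpan_le_subdivide d i j l)

theorem apply_eq_zero_of_mem_edgeSpan {d : Fin N × Fin N →₀ ℕ} {j : Fin N} (hj : j ∉ ends d)
    {x : Fin N → ℚ} (hx : x ∈ edgeSpan d) : x j = 0 := by
  have : edgeSpan d ≤ LinearMap.ker (LinearMap.proj (R := ℚ) (φ := fun _ => ℚ) j) := by
    refine edgeSpan_le.mpr fun p hp => ?_
    have h1 : j ≠ p.1 := by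
      rintro rfl
      exact hj (Finset.mem_union_left _ (Finset.mem_image_of_mem _ (by simpa using hp)))
    have h2 : j ≠ p.2 := by
      rintro rfl
      exact hj (Finset.mem_union_right _ (Finset.mem_image_of_mem _ (by simpa using hp)))
    simp [edgeVector, h1, h2]
  exact this hx

/-- Subdividing an edge by a new vertex increases the rank. -/
theorem forestRank_lt_subdivide (d : Fin N × Fin N →₀ ℕ) (i j l : Fin N)
    (hj : j ∉ ends (d + Finsupp.single (i, l) 1)) :
    forestRank (d + Finsupp.single (i, l) 1) + 1 ≤
      forestRank (d + Finsupp.single (i, j) 1 + Finsupp.single (j, l) 1) := by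
  refine Submodule.finrank_lt_finrank_of_lt
    (lt_of_le_of_ne (edgeSpan_le_subdivide d i j l) fun h => ?_)
  have hij : j ≠ i := by
    rintro rfl
    refine hj (Finset.mem_union_left _ (Finset.mem_image.mpr ⟨(j, l), ?_, rfl⟩))
    simp
  -- Equal spans would contain a vector that is nonzero at `j`, while the old span vanishes there.
  have h1 : edgeVector (i, j) ∈ edgeSpan (d + Finsupp.single (i, l) 1) := by
    rw [h]
    exact edgeVector_mem (by simp)
  have h2 := apply_eq_zero_of_mem_edgeSpan hj h1
  simp [edgeVector, hij] at h2

theorem card_support_le_degree {σ : Type*} (d : σ →₀ ℕ) : d.support.card ≤ d.degree := by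
  rw [Finset.card_eq_sum_ones, Finsupp.degree_apply]
  exact Finset.sum_le_sum fun p hp => Nat.one_le_iff_ne_zero.mpr (by simpa using hp)

theorem card_ends_le (d : Fin N × Fin N →₀ ℕ) : (ends d).card ≤ 2 * d.degree := by
  have h := card_support_le_degree d
  have h1 := Finset.card_image_le (s := d.support) (f := Prod.fst)
  have h2 := Finset.card_image_le (s := d.support) (f := Prod.snd)
  have h3 := Finset.card_union_le (d.support.image Prod.fst) (d.support.image Prod.snd)
  rw [ends]
  omega

/-- The number of ways to distribute the edges over two trees is bounded by the degree alone,
independently of `N`. -/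
theorem card_antidiagonal_le {σ : Type*} [DecidableEq σ] (d : σ →₀ ℕ) :
    (Finset.HasAntidiagonal.antidiagonal d).card ≤ 2 ^ d.degree := by
  have h1 : (Finset.HasAntidiagonal.antidiagonal d).card ≤ (Finset.Iic d).card := by
    refine Finset.card_le_card_of_injOn Prod.fst (fun x hx => ?_) fun x hx y hy h => ?_
    · rw [Finset.mem_coe, Finset.HasAntidiagonal.mem_antidiagonal] at hx
      simp [← hx]
    · rw [Finset.mem_coe, Finset.HasAntidiagonal.mem_antidiagonal] at hx hy
      refine Prod.ext h ?_
      rw [← hy, h] at hx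
      exact add_left_cancel hx
  refine h1.trans ?_
  rw [Finsupp.card_Iic, Finsupp.degree_apply, ← Finset.prod_pow_eq_pow_sum]
  refine Finset.prod_le_prod' fun p _ => ?_
  rw [Nat.card_Iic]
  exact Nat.lt_two_pow_self

end Rank

/-! ### Power counting -/

section PowerCounting

open MvPowerSeries

variable {N : ℕ}

/-- The absolute value of a coefficient, scaled by `N ^ (v - c - e / 2)`. -/
def scaledCoeff (f : SourceSeries N) (d : Fin N × Fin N →₀ ℕ) : ℝ :=
  (N : ℝ) ^ ((forestRank d : ℝ) - (d.degree : ℝ) / 2) * ‖coeff d f‖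

theorem scaledCoeff_nonneg (f : SourceSeries N) (d : Fin N × Fin N →₀ ℕ) :
    0 ≤ scaledCoeff f d := by
  rw [scaledCoeff]
  positivity

theorem norm_coeff_eq (hN : 1 ≤ N) (f : SourceSeries N) (d : Fin N × Fin N →₀ ℕ) :
    ‖coeff d f‖ = (N : ℝ) ^ ((d.degree : ℝ) / 2 - (forestRank d : ℝ)) * scaledCoeff f d := by
  have hN' : (0 : ℝ) < N := by exact_mod_cast hN
  rw [scaledCoeff, ← mul_assoc, ← Real.rpow_add hN', sub_add_sub_cancel, sub_self, Real.rpow_zero,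
    one_mul]

theorem scaledCoeff_add_le (f g : SourceSeries N) (d : Fin N × Fin N →₀ ℕ) :
    scaledCoeff (f + g) d ≤ scaledCoeff f d + scaledCoeff g d := by
  rw [scaledCoeff, scaledCoeff, scaledCoeff, ← mul_add, map_add]
  exact mul_le_mul_of_nonneg_left (norm_add_le _ _) (by positivity)

theorem scaledCoeff_C_mul (z : ℂ) (f : SourceSeries N) (d : Fin N × Fin N →₀ ℕ) :
    scaledCoeff (C z * f) d = ‖z‖ * scaledCoeff f d := by
  rw [scaledCoeff, scaledCoeff, coeff_C_mul, norm_mul]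
  ring

theorem scaledCoeff_neg (f : SourceSeries N) (d : Fin N × Fin N →₀ ℕ) :
    scaledCoeff (-f) d = scaledCoeff f d := by
  rw [scaledCoeff, scaledCoeff, map_neg, norm_neg]

/-- The sum over the position of the subdividing vertex costs no power of `N`. -/
theorem sum_subdivide_le (hN : 1 ≤ N) (d : Fin N × Fin N →₀ ℕ) (i l : Fin N) :
    ∑ j, (N : ℝ) ^ ((forestRank (d + Finsupp.single (i, l) 1) : ℝ) -
      forestRank (d + Finsupp.single (i, j) 1 + Finsupp.single (j, l) 1)) ≤
        2 * (d + Finsupp.single (i, l) 1).degree + 1 := by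
  classical
  have hN1 : (1 : ℝ) ≤ N := by exact_mod_cast hN
  have hN0 : (0 : ℝ) < N := by linarith
  set E := ends (d + Finsupp.single (i, l) 1) with hE
  have h1 : ∀ j, (N : ℝ) ^ ((forestRank (d + Finsupp.single (i, l) 1) : ℝ) -
      forestRank (d + Finsupp.single (i, j) 1 + Finsupp.single (j, l) 1)) ≤
        (if j ∈ E then 1 else 0) + (N : ℝ)⁻¹ := by
    intro j
    split_ifs with hj
    · have h : (forestRank (d + Finsupp.single (i, l) 1) : ℝ) ≤
          forestRank (d + Finsupp.single (i, j) 1 + Finsupp.single (j, l) 1) := by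
        exact_mod_cast forestRank_le_subdivide d i j l
      have := Real.rpow_le_one_of_one_le_of_nonpos hN1 (sub_nonpos.mpr h)
      have : (0 : ℝ) ≤ (N : ℝ)⁻¹ := by positivity
      linarith
    · have h : (forestRank (d + Finsupp.single (i, l) 1) : ℝ) + 1 ≤
          forestRank (d + Finsupp.single (i, j) 1 + Finsupp.single (j, l) 1) := by
        exact_mod_cast forestRank_lt_subdivide d i j l hj
      rw [zero_add, ← Real.rpow_neg_one]
      exact Real.rpow_le_rpow_of_exponent_le hN1 (by linarith)
  refine (Finset.sum_le_sum fun j _ => h1 j).trans ?_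
  rw [Finset.sum_add_distrib, Finset.sum_ite_mem, Finset.univ_inter, Finset.sum_const,
    Finset.sum_const, Finset.card_univ, Fintype.card_fin, nsmul_eq_mul, nsmul_eq_mul, mul_one,
    mul_inv_cancel₀ hN0.ne']
  have := card_ends_le (d + Finsupp.single (i, l) 1)
  have : (E.card : ℝ) ≤ 2 * (d + Finsupp.single (i, l) 1).degree := by exact_mod_cast this
  linarith

theorem coeff_X_mul_eq_zero {σ : Type*} {d : σ →₀ ℕ} {p : σ} (hp : d p = 0)
    (f : MvPowerSeries σ ℂ) : coeff d (X p * f) = 0 := by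
  classical
  rw [X, coeff_monomial_mul, if_neg]
  simp [hp]

/-- Power counting for the terms of the flow, all of which subdivide an edge. -/
theorem scaledCoeff_subdivide_le (hN : 1 ≤ N) (d : Fin N × Fin N →₀ ℕ)
    (A : Fin N → Fin N → Fin N → SourceSeries N) {η : ℝ} (hη : 0 ≤ η)
    (hA : ∀ i l j d₀, d = d₀ + Finsupp.single (i, l) 1 → ‖coeff d₀ (A i l j)‖ ≤
      (N : ℝ) ^ (((d.degree : ℝ) + 1) / 2 -
        forestRank (d₀ + Finsupp.single (i, j) 1 + Finsupp.single (j, l) 1)) * η) :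
    scaledCoeff (C (((Real.sqrt N)⁻¹ : ℝ) : ℂ) * ∑ i, ∑ l, ∑ j, X (i, l) * A i l j) d ≤
      d.degree * (2 * d.degree + 1) * η := by
  classical
  have hN0 : (0 : ℝ) < N := by exact_mod_cast hN
  have hsqrt : ‖(((Real.sqrt N)⁻¹ : ℝ) : ℂ)‖ = (N : ℝ) ^ (-(1 / 2) : ℝ) := by
    rw [Complex.norm_real, Real.norm_of_nonneg (by positivity), Real.sqrt_eq_rpow,
      Real.rpow_neg hN0.le]
  set s : ℝ := (N : ℝ) ^ ((forestRank d : ℝ) - (d.degree : ℝ) / 2) with hs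
  have hs0 : 0 ≤ s := by positivity
  have hterm : ∀ i l, ‖(((Real.sqrt N)⁻¹ : ℝ) : ℂ)‖ * (s * ‖∑ j, coeff d (X (i, l) * A i l j)‖) ≤
      if (i, l) ∈ d.support then (2 * d.degree + 1) * η else 0 := by
    intro i l
    split_ifs with hil
    · obtain ⟨d₀, hd₀⟩ : ∃ d₀, d = d₀ + Finsupp.single (i, l) 1 := by
        refine ⟨d - Finsupp.single (i, l) 1, (tsub_add_cancel_of_le ?_).symm⟩
        rw [Finsupp.single_le_iff]
        exact Nat.one_le_iff_ne_zero.mpr (by simpa using hil)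
      -- The exponents `-1 / 2`, `-deg / 2` and `(deg + 1) / 2` cancel, which leaves only the
      -- difference of ranks.
      have h1 : ∀ j, ‖(((Real.sqrt N)⁻¹ : ℝ) : ℂ)‖ * (s * ‖coeff d (X (i, l) * A i l j)‖) ≤
          (N : ℝ) ^ ((forestRank (d₀ + Finsupp.single (i, l) 1) : ℝ) -
            forestRank (d₀ + Finsupp.single (i, j) 1 + Finsupp.single (j, l) 1)) * η := by
        intro j
        have h2 : coeff d (X (i, l) * A i l j) = coeff d₀ (A i l j) := by
          rw [hd₀, add_comm, X, coeff_add_monomial_mul, one_mul]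
        rw [h2, hsqrt, ← mul_assoc]
        refine (mul_le_mul_of_nonneg_left (hA i l j d₀ hd₀) (by positivity)).trans (le_of_eq ?_)
        rw [← mul_assoc, hs, ← Real.rpow_add hN0, ← Real.rpow_add hN0, ← hd₀]
        congr 2
        ring
      calc _ ≤ ‖(((Real.sqrt N)⁻¹ : ℝ) : ℂ)‖ * (s * ∑ j, ‖coeff d (X (i, l) * A i l j)‖) := by
            gcongr
            exact norm_sum_le _ _
        _ = ∑ j, ‖(((Real.sqrt N)⁻¹ : ℝ) : ℂ)‖ * (s * ‖coeff d (X (i, l) * A i l j)‖) := by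
            rw [Finset.mul_sum, Finset.mul_sum]
        _ ≤ _ := Finset.sum_le_sum fun j _ => h1 j
        _ ≤ _ := by
            rw [← Finset.sum_mul, hd₀]
            exact mul_le_mul_of_nonneg_right (sum_subdivide_le hN d₀ i l) hη
    · have h0 : d (i, l) = 0 := by simpa using hil
      rw [Finset.sum_eq_zero fun j _ => coeff_X_mul_eq_zero h0 _]
      simp
  rw [scaledCoeff_C_mul, scaledCoeff, ← hs]
  simp only [map_sum]
  calc _ ≤ ‖(((Real.sqrt N)⁻¹ : ℝ) : ℂ)‖ *
        (s * ∑ i, ∑ l, ‖∑ j, coeff d (X (i, l) * A i l j)‖) := by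
        gcongr
        exact (norm_sum_le _ _).trans (Finset.sum_le_sum fun i _ => norm_sum_le _ _)
    _ = ∑ i, ∑ l, ‖(((Real.sqrt N)⁻¹ : ℝ) : ℂ)‖ *
        (s * ‖∑ j, coeff d (X (i, l) * A i l j)‖) := by
        simp only [Finset.mul_sum]
    _ ≤ ∑ i, ∑ l, if (i, l) ∈ d.support then (2 * d.degree + 1) * η else 0 :=
        Finset.sum_le_sum fun i _ => Finset.sum_le_sum fun l _ => hterm i l
    _ = d.support.card * ((2 * d.degree + 1) * η) := by
        rw [← Fintype.sum_prod_type' fun i l => if (i, l) ∈ d.support then (2 * d.degree + 1) * η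
          else 0]
        simp only [Prod.mk.eta]
        rw [Finset.sum_ite_mem, Finset.univ_inter, Finset.sum_const, nsmul_eq_mul]
    _ ≤ d.degree * ((2 * d.degree + 1) * η) := by
        refine mul_le_mul_of_nonneg_right ?_ (by positivity)
        exact_mod_cast card_support_le_degree d
    _ = _ := by ring

theorem norm_natCast_add_one (m : ℕ) : ‖((m : ℂ) + 1)‖ = m + 1 := by
  have : ((m : ℂ) + 1) = ((m + 1 : ℕ) : ℂ) := by push_cast; rfl
  rw [this, Complex.norm_natCast]
  push_cast
  rfl

/-- The bound is required only for the imbalance of `d`, so the same estimate serves both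
boundedness and vanishing on balanced graphs. The two derivatives cost at most `(deg + 1) ^ 2`. -/
theorem scaledCoeff_loopTerm_le (hN : 1 ≤ N) (f : SourceSeries N) (d : Fin N × Fin N →₀ ℕ) {η : ℝ}
    (hη : 0 ≤ η)
    (hf : ∀ d', d'.degree = d.degree + 1 → imbalance d' = imbalance d → scaledCoeff f d' ≤ η) :
    scaledCoeff (loopTerm f) d ≤
      d.degree * (2 * d.degree + 1) * (((d.degree : ℝ) + 1) ^ 2 * η) := by
  refine scaledCoeff_subdivide_le hN d _ (by positivity) fun i l j d₀ hd₀ => ?_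
  rw [coeff_pderiv, coeff_pderiv, norm_mul, norm_mul, norm_natCast_add_one, norm_natCast_add_one,
    add_right_comm d₀]
  set d' := d₀ + Finsupp.single (i, j) 1 + Finsupp.single (j, l) 1 with hd'
  have hdeg : d'.degree = d.degree + 1 := by
    rw [hd₀, hd']
    simp only [map_add, Finsupp.degree_single]
  have himb : imbalance d' = imbalance d := by
    rw [hd₀, hd', imbalance_add, imbalance_add, imbalance_add, imbalance_single, imbalance_single,
      imbalance_single, add_assoc, edgeVector_add]
  have h1 : (d₀ + Finsupp.single (j, l) 1 : Fin N × Fin N →₀ ℕ) (i, j) ≤ d.degree := by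
    refine (Finsupp.le_degree _ _).trans (le_of_eq ?_)
    rw [hd₀]
    simp only [map_add, Finsupp.degree_single]
  have h2 : d₀ (j, l) ≤ d.degree := by
    refine (Finsupp.le_degree _ _).trans ?_
    rw [hd₀, map_add]
    exact Nat.le_add_right _ _
  have h1' : (((d₀ + Finsupp.single (j, l) 1 : Fin N × Fin N →₀ ℕ) (i, j) : ℕ) : ℝ) ≤
      d.degree := by exact_mod_cast h1
  have h2' : (d₀ (j, l) : ℝ) ≤ d.degree := by exact_mod_cast h2
  rw [norm_coeff_eq hN, hdeg, Nat.cast_add, Nat.cast_one]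
  calc _ ≤ (N : ℝ) ^ (((d.degree : ℝ) + 1) / 2 - forestRank d') * η * (d.degree + 1) *
        (d.degree + 1) := by
        gcongr
        exact hf d' hdeg himb
    _ = _ := by ring

/-- The power of `N` measuring the defect of additivity of the rank is kept in the hypothesis: it is
the only gain available when both factors are unbalanced. -/
theorem scaledCoeff_treeTerm_le (hN : 1 ≤ N) (f g : SourceSeries N) (d : Fin N × Fin N →₀ ℕ)
    {η : ℝ} (hη : 0 ≤ η)
    (hfg : ∀ d₁ d₂, d₁.degree + d₂.degree = d.degree + 1 → imbalance (d₁ + d₂) = imbalance d →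
      (N : ℝ) ^ ((forestRank (d₁ + d₂) : ℝ) - forestRank d₁ - forestRank d₂) *
        (scaledCoeff f d₁ * scaledCoeff g d₂) ≤ η) :
    scaledCoeff (treeTerm f g) d ≤
      d.degree * (2 * d.degree + 1) * (2 ^ d.degree * (((d.degree : ℝ) + 1) ^ 2 * η)) := by
  classical
  have hN0 : (0 : ℝ) < N := by exact_mod_cast hN
  refine scaledCoeff_subdivide_le hN d _ (by positivity) fun i l j d₀ hd₀ => ?_
  set d' := d₀ + Finsupp.single (i, j) 1 + Finsupp.single (j, l) 1 with hd'
  have hdeg' : d.degree = d₀.degree + 1 := by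
    rw [hd₀, map_add, Finsupp.degree_single]
  rw [coeff_mul]
  have hterm : ∀ x ∈ Finset.HasAntidiagonal.antidiagonal d₀,
      ‖coeff x.1 (pderiv ℂ (j, l) f) * coeff x.2 (pderiv ℂ (i, j) g)‖ ≤
        (N : ℝ) ^ (((d.degree : ℝ) + 1) / 2 - forestRank d') * (((d.degree : ℝ) + 1) ^ 2 * η) := by
    intro x hx
    rw [Finset.HasAntidiagonal.mem_antidiagonal] at hx
    set d₁ := x.1 + Finsupp.single (j, l) 1 with hd₁
    set d₂ := x.2 + Finsupp.single (i, j) 1 with hd₂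
    have hsum : d₁ + d₂ = d' := by
      rw [hd₁, hd₂, hd', ← hx]
      abel
    have hx' : x.1.degree + x.2.degree = d₀.degree := by rw [← hx, map_add]
    have hdeg : d₁.degree + d₂.degree = d.degree + 1 := by
      rw [hd₁, hd₂, map_add, map_add, Finsupp.degree_single, Finsupp.degree_single]
      omega
    have himb : imbalance (d₁ + d₂) = imbalance d := by
      rw [hsum, hd₀, hd', imbalance_add, imbalance_add, imbalance_add, imbalance_single,
        imbalance_single, imbalance_single, add_assoc, edgeVector_add]
    have h1 : (x.1 (j, l) : ℝ) ≤ d.degree := by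
      have := Finsupp.le_degree (j, l) x.1
      exact_mod_cast (by omega : x.1 (j, l) ≤ d.degree)
    have h2 : (x.2 (i, j) : ℝ) ≤ d.degree := by
      have := Finsupp.le_degree (i, j) x.2
      exact_mod_cast (by omega : x.2 (i, j) ≤ d.degree)
    have hdegR : (d₁.degree : ℝ) + d₂.degree = d.degree + 1 := by exact_mod_cast hdeg
    rw [coeff_pderiv, coeff_pderiv, norm_mul, norm_mul, norm_mul, norm_natCast_add_one,
      norm_natCast_add_one, ← hd₁, ← hd₂, norm_coeff_eq hN, norm_coeff_eq hN]
    have hpow : (N : ℝ) ^ ((d₁.degree : ℝ) / 2 - forestRank d₁) *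
        (N : ℝ) ^ ((d₂.degree : ℝ) / 2 - forestRank d₂) =
        (N : ℝ) ^ (((d.degree : ℝ) + 1) / 2 - forestRank d') *
          (N : ℝ) ^ ((forestRank (d₁ + d₂) : ℝ) - forestRank d₁ - forestRank d₂) := by
      rw [← Real.rpow_add hN0, ← Real.rpow_add hN0, hsum, ← hdegR]
      congr 1
      ring
    have h0 := scaledCoeff_nonneg f d₁
    have h0' := scaledCoeff_nonneg g d₂
    calc _ = ((N : ℝ) ^ ((d₁.degree : ℝ) / 2 - forestRank d₁) *
          (N : ℝ) ^ ((d₂.degree : ℝ) / 2 - forestRank d₂)) *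
          (scaledCoeff f d₁ * scaledCoeff g d₂) * ((x.1 (j, l) + 1) * (x.2 (i, j) + 1)) := by ring
      _ = (N : ℝ) ^ (((d.degree : ℝ) + 1) / 2 - forestRank d') *
          ((N : ℝ) ^ ((forestRank (d₁ + d₂) : ℝ) - forestRank d₁ - forestRank d₂) *
            (scaledCoeff f d₁ * scaledCoeff g d₂)) *
          ((x.1 (j, l) + 1) * (x.2 (i, j) + 1)) := by rw [hpow]; ring
      _ ≤ (N : ℝ) ^ (((d.degree : ℝ) + 1) / 2 - forestRank d') * η *
          ((d.degree + 1) * (d.degree + 1)) := by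
          gcongr
          exact hfg d₁ d₂ hdeg himb
      _ = _ := by ring
  refine (norm_sum_le _ _).trans ((Finset.sum_le_sum hterm).trans ?_)
  rw [Finset.sum_const, nsmul_eq_mul, mul_left_comm]
  refine mul_le_mul_of_nonneg_left (mul_le_mul_of_nonneg_right ?_ (by positivity)) (by positivity)
  have h1 : (Finset.HasAntidiagonal.antidiagonal d₀).card ≤ 2 ^ d.degree :=
    (card_antidiagonal_le d₀).trans (Nat.pow_le_pow_right (by norm_num) (by omega))
  exact_mod_cast h1

end PowerCounting

/-! ### Asymptotics of sequences of power series -/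

section Asymptotics

open MvPowerSeries

/-- The scaled coefficients are bounded, uniformly in `N` for a bounded degree. -/
def CoeffBounded (f : (N : ℕ) → SourceSeries N) : Prop :=
  ∀ e : ℕ, ∃ B : ℝ, ∀ N : ℕ, 1 ≤ N → ∀ d : Fin N × Fin N →₀ ℕ, d.degree ≤ e →
    scaledCoeff (f N) d ≤ B

/-- The scaled coefficients of balanced monomials tend to zero, uniformly for a bounded degree. -/
def BalancedVanishing (f : (N : ℕ) → SourceSeries N) : Prop :=
  ∀ e : ℕ, ∀ ε : ℝ, 0 < ε → ∃ N₀ : ℕ, ∀ N : ℕ, 1 ≤ N → N₀ ≤ N → ∀ d : Fin N × Fin N →₀ ℕ,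
    d.degree ≤ e → imbalance d = 0 → scaledCoeff (f N) d ≤ ε

variable {f g : (N : ℕ) → SourceSeries N}

theorem CoeffBounded.exists_nonneg (hf : CoeffBounded f) (e : ℕ) :
    ∃ B : ℝ, 0 ≤ B ∧ ∀ N : ℕ, 1 ≤ N → ∀ d : Fin N × Fin N →₀ ℕ, d.degree ≤ e →
      scaledCoeff (f N) d ≤ B := by
  obtain ⟨B, hB⟩ := hf e
  exact ⟨|B|, abs_nonneg B, fun N hN d hd => (hB N hN d hd).trans (le_abs_self B)⟩

theorem CoeffBounded.add (hf : CoeffBounded f) (hg : CoeffBounded g) :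
    CoeffBounded fun N => f N + g N := by
  intro e
  obtain ⟨B, hB⟩ := hf e
  obtain ⟨B', hB'⟩ := hg e
  exact ⟨B + B', fun N hN d hd =>
    (scaledCoeff_add_le _ _ _).trans (add_le_add (hB N hN d hd) (hB' N hN d hd))⟩

theorem CoeffBounded.neg (hf : CoeffBounded f) : CoeffBounded fun N => -f N := by
  intro e
  obtain ⟨B, hB⟩ := hf e
  exact ⟨B, fun N hN d hd => (scaledCoeff_neg _ _).trans_le (hB N hN d hd)⟩

theorem CoeffBounded.sub (hf : CoeffBounded f) (hg : CoeffBounded g) :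
    CoeffBounded fun N => f N - g N := by
  simpa only [sub_eq_add_neg] using hf.add hg.neg

theorem CoeffBounded.C_mul (z : ℂ) (hf : CoeffBounded f) : CoeffBounded fun N => C z * f N := by
  intro e
  obtain ⟨B, hB⟩ := hf e
  exact ⟨‖z‖ * B, fun N hN d hd => (scaledCoeff_C_mul _ _ _).trans_le
    (mul_le_mul_of_nonneg_left (hB N hN d hd) (norm_nonneg z))⟩

theorem coeffBounded_zero : CoeffBounded fun _ => 0 :=
  fun _ => ⟨0, fun N _ d _ => by simp [scaledCoeff]⟩

theorem CoeffBounded.sum {ι : Type*} (s : Finset ι) {f : ι → (N : ℕ) → SourceSeries N}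
    (h : ∀ i ∈ s, CoeffBounded (f i)) : CoeffBounded fun N => ∑ i ∈ s, f i N := by
  classical
  induction s using Finset.induction_on with
  | empty => simpa using coeffBounded_zero
  | insert i s hi ih =>
    simp only [Finset.sum_insert hi]
    exact (h i (by simp)).add (ih fun j hj => h j (by simp [hj]))

theorem BalancedVanishing.add (hf : BalancedVanishing f) (hg : BalancedVanishing g) :
    BalancedVanishing fun N => f N + g N := by
  intro e ε hε
  obtain ⟨N₁, h₁⟩ := hf e (ε / 2) (half_pos hε)
  obtain ⟨N₂, h₂⟩ := hg e (ε / 2) (half_pos hε)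
  refine ⟨max N₁ N₂, fun N hN hN₀ d hd hb => (scaledCoeff_add_le _ _ _).trans ?_⟩
  have := h₁ N hN ((le_max_left _ _).trans hN₀) d hd hb
  have := h₂ N hN ((le_max_right _ _).trans hN₀) d hd hb
  linarith

/-- It suffices to bound the scaled coefficients by a constant times an arbitrary `ε`. -/
theorem BalancedVanishing.of_mul_le (h : ∀ e : ℕ, ∃ A : ℝ, 0 ≤ A ∧ ∀ ε : ℝ, 0 < ε → ∃ N₀ : ℕ,
    ∀ N : ℕ, 1 ≤ N → N₀ ≤ N → ∀ d : Fin N × Fin N →₀ ℕ, d.degree ≤ e → imbalance d = 0 →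
      scaledCoeff (f N) d ≤ A * ε) : BalancedVanishing f := by
  intro e ε hε
  obtain ⟨A, hA, h⟩ := h e
  -- `A + 1` avoids a division by zero when `A = 0`.
  obtain ⟨N₀, hN₀⟩ := h (ε / (A + 1)) (by positivity)
  refine ⟨N₀, fun N hN hNN d hd hb => (hN₀ N hN hNN d hd hb).trans ?_⟩
  rw [mul_div_assoc', div_le_iff₀ (by positivity)]
  nlinarith

theorem BalancedVanishing.C_mul (z : ℂ) (hf : BalancedVanishing f) :
    BalancedVanishing fun N => C z * f N := by
  refine .of_mul_le fun e => ⟨‖z‖, norm_nonneg z, fun ε hε => ?_⟩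
  obtain ⟨N₀, h⟩ := hf e ε hε
  exact ⟨N₀, fun N hN hNN d hd hb => (scaledCoeff_C_mul _ _ _).trans_le
    (mul_le_mul_of_nonneg_left (h N hN hNN d hd hb) (norm_nonneg z))⟩

theorem balancedVanishing_zero : BalancedVanishing fun _ => 0 :=
  fun _ ε hε => ⟨0, fun N _ _ d _ _ => by simpa [scaledCoeff] using hε.le⟩

theorem BalancedVanishing.sum {ι : Type*} (s : Finset ι) {f : ι → (N : ℕ) → SourceSeries N}
    (h : ∀ i ∈ s, BalancedVanishing (f i)) : BalancedVanishing fun N => ∑ i ∈ s, f i N := by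
  classical
  induction s using Finset.induction_on with
  | empty => simpa using balancedVanishing_zero
  | insert i s hi ih =>
    simp only [Finset.sum_insert hi]
    exact (h i (by simp)).add (ih fun j hj => h j (by simp [hj]))

theorem CoeffBounded.loopTerm (hf : CoeffBounded f) :
    CoeffBounded fun N => loopTerm (f N) := by
  intro e
  obtain ⟨B, hB0, hB⟩ := hf.exists_nonneg (e + 1)
  refine ⟨e * (2 * e + 1) * (((e : ℝ) + 1) ^ 2 * B), fun N hN d hd => ?_⟩
  have hd' : (d.degree : ℝ) ≤ e := by exact_mod_cast hd
  refine (scaledCoeff_loopTerm_le hN (f N) d hB0 fun d' hdeg _ =>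
    hB N hN d' (by omega)).trans ?_
  gcongr

/-- A loop involves a single graph, whose imbalance is unchanged, so unbalanced coefficients never
enter. -/
theorem BalancedVanishing.loopTerm (hf : BalancedVanishing f) :
    BalancedVanishing fun N => ReplicaWigner.loopTerm (f N) := by
  refine .of_mul_le fun e => ⟨e * (2 * e + 1) * ((e : ℝ) + 1) ^ 2, by positivity, fun ε hε => ?_⟩
  obtain ⟨N₀, h⟩ := hf (e + 1) ε hε
  refine ⟨N₀, fun N hN hNN d hd hb => ?_⟩
  have hd' : (d.degree : ℝ) ≤ e := by exact_mod_cast hd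
  refine (scaledCoeff_loopTerm_le hN (f N) d hε.le fun d' hdeg himb =>
    h N hN hNN d' (by omega) (himb.trans hb)).trans ?_
  rw [mul_assoc _ (((e : ℝ) + 1) ^ 2)]
  gcongr

theorem rpow_forestRank_le_one {N : ℕ} (hN : 1 ≤ N) (d₁ d₂ : Fin N × Fin N →₀ ℕ) :
    (N : ℝ) ^ ((forestRank (d₁ + d₂) : ℝ) - forestRank d₁ - forestRank d₂) ≤ 1 := by
  have hN1 : (1 : ℝ) ≤ N := by exact_mod_cast hN
  have h : (forestRank (d₁ + d₂) : ℝ) ≤ forestRank d₁ + forestRank d₂ := by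
    exact_mod_cast forestRank_add_le d₁ d₂
  exact Real.rpow_le_one_of_one_le_of_nonpos hN1 (by linarith)

theorem CoeffBounded.treeTerm (hf : CoeffBounded f) (hg : CoeffBounded g) :
    CoeffBounded fun N => treeTerm (f N) (g N) := by
  intro e
  obtain ⟨B, hB0, hB⟩ := hf.exists_nonneg (e + 1)
  obtain ⟨B', hB0', hB'⟩ := hg.exists_nonneg (e + 1)
  refine ⟨e * (2 * e + 1) * (2 ^ e * (((e : ℝ) + 1) ^ 2 * (B * B'))), fun N hN d hd => ?_⟩
  have hd' : (d.degree : ℝ) ≤ e := by exact_mod_cast hd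
  refine (scaledCoeff_treeTerm_le hN (f N) (g N) d (mul_nonneg hB0 hB0')
    fun d₁ d₂ hdeg _ => ?_).trans ?_
  · rw [← one_mul (B * B')]
    exact mul_le_mul (rpow_forestRank_le_one hN d₁ d₂)
      (mul_le_mul (hB N hN d₁ (by omega)) (hB' N hN d₂ (by omega)) (scaledCoeff_nonneg _ _) hB0)
      (mul_nonneg (scaledCoeff_nonneg _ _) (scaledCoeff_nonneg _ _)) zero_le_one
  · gcongr
    norm_num

/-- A product with a factor of order `N⁰` on every graph and a vanishing contribution of the
balanced graphs vanishes on balanced graphs: unbalanced graphs joined into a balanced one have a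
cycle in common, which costs a power of `N`. -/
theorem BalancedVanishing.treeTerm_of_mul (hf : CoeffBounded f) (hg : CoeffBounded g)
    (h : BalancedVanishing f ∨ BalancedVanishing g) :
    BalancedVanishing fun N => treeTerm (f N) (g N) := by
  refine .of_mul_le fun e => ?_
  obtain ⟨B, hB0, hB⟩ := hf.exists_nonneg (e + 1)
  obtain ⟨B', hB0', hB'⟩ := hg.exists_nonneg (e + 1)
  -- `B + B'` covers two balanced factors, one of which is at most `ε`. `B * B'` covers two
  -- unbalanced ones, where `ε` comes from `N⁻¹`.
  refine ⟨e * (2 * e + 1) * (2 ^ e * ((e : ℝ) + 1) ^ 2) * (B * B' + B + B'), by positivity,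
    fun ε hε => ?_⟩
  obtain ⟨N₁, hN₁⟩ : ∃ N₁ : ℕ, ∀ N : ℕ, 1 ≤ N → N₁ ≤ N → ∀ d₁ d₂ : Fin N × Fin N →₀ ℕ,
      d₁.degree ≤ e + 1 → d₂.degree ≤ e + 1 → imbalance d₁ = 0 → imbalance d₂ = 0 →
        scaledCoeff (f N) d₁ * scaledCoeff (g N) d₂ ≤ (B + B') * ε := by
    rcases h with h | h
    · obtain ⟨N₁, h⟩ := h (e + 1) ε hε
      refine ⟨N₁, fun N hN hNN d₁ d₂ h₁ h₂ hb₁ _ => ?_⟩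
      calc _ ≤ ε * B' := mul_le_mul (h N hN hNN d₁ h₁ hb₁) (hB' N hN d₂ h₂)
            (scaledCoeff_nonneg _ _) hε.le
        _ ≤ _ := by nlinarith
    · obtain ⟨N₁, h⟩ := h (e + 1) ε hε
      refine ⟨N₁, fun N hN hNN d₁ d₂ h₁ h₂ _ hb₂ => ?_⟩
      calc _ ≤ B * ε := mul_le_mul (hB N hN d₁ h₁) (h N hN hNN d₂ h₂ hb₂)
            (scaledCoeff_nonneg _ _) hB0
        _ ≤ _ := by nlinarith
  obtain ⟨N₂, hN₂⟩ := exists_nat_gt ε⁻¹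
  refine ⟨max N₁ N₂, fun N hN hNN d hd hb => ?_⟩
  have hd' : (d.degree : ℝ) ≤ e := by exact_mod_cast hd
  have hN1 : (1 : ℝ) ≤ N := by exact_mod_cast hN
  have hinv : (N : ℝ)⁻¹ ≤ ε := by
    refine inv_le_of_inv_le₀ hε (hN₂.le.trans ?_)
    exact_mod_cast (le_max_right _ _).trans hNN
  refine (scaledCoeff_treeTerm_le hN (f N) (g N) d (η := (B * B' + B + B') * ε) (by positivity)
    fun d₁ d₂ hdeg himb => ?_).trans ?_
  · have h0 := mul_nonneg (scaledCoeff_nonneg (f N) d₁) (scaledCoeff_nonneg (g N) d₂)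
    by_cases hd₁ : imbalance d₁ = 0
    · have hd₂ : imbalance d₂ = 0 := by
        rw [hb, imbalance_add, hd₁, zero_add] at himb
        exact himb
      calc _ ≤ 1 * ((B + B') * ε) := mul_le_mul (rpow_forestRank_le_one hN d₁ d₂)
            (hN₁ N hN ((le_max_left _ _).trans hNN) d₁ d₂ (by omega) (by omega) hd₁ hd₂) h0
            zero_le_one
        _ ≤ _ := by
            have := mul_nonneg (mul_nonneg hB0 hB0') hε.le
            nlinarith
    · have hlt : (forestRank (d₁ + d₂) : ℝ) + 1 ≤ forestRank d₁ + forestRank d₂ := by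
        exact_mod_cast forestRank_add_lt (himb.trans hb) hd₁
      have hpow : (N : ℝ) ^ ((forestRank (d₁ + d₂) : ℝ) - forestRank d₁ - forestRank d₂) ≤ ε := by
        refine le_trans ?_ hinv
        rw [← Real.rpow_neg_one]
        exact Real.rpow_le_rpow_of_exponent_le hN1 (by linarith)
      calc _ ≤ ε * (B * B') := mul_le_mul hpow (mul_le_mul (hB N hN d₁ (by omega))
            (hB' N hN d₂ (by omega)) (scaledCoeff_nonneg _ _) hB0) h0 hε.le
        _ ≤ _ := by nlinarith [mul_nonneg hB0 hε.le, mul_nonneg hB0' hε.le]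
  · have : (d.degree : ℝ) * (2 * d.degree + 1) * (2 ^ d.degree * (((d.degree : ℝ) + 1) ^ 2 *
        ((B * B' + B + B') * ε))) ≤ e * (2 * e + 1) * (2 ^ e * (((e : ℝ) + 1) ^ 2 *
        ((B * B' + B + B') * ε))) := by
      gcongr
      norm_num
    refine this.trans (le_of_eq ?_)
    ring

/-- Setting `z = 0` is essential to the estimate: `replicaTerm` sums over `N` self-loops, which do
not change the rank, and the same power counting would allow a growth by `N`. -/
theorem CoeffBounded.flowCoeff {K : (N : ℕ) → SourceSeries N} (hK : CoeffBounded K) (k : ℕ) :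
    CoeffBounded fun N => flowCoeff 0 (K N) k := by
  induction k using Nat.strong_induction_on with
  | _ k ih =>
    cases k with
    | zero =>
      simp only [ReplicaWigner.flowCoeff]
      exact hK
    | succ k =>
      simp only [ReplicaWigner.flowCoeff, map_zero, zero_mul, zero_add]
      exact .C_mul _ (.add (ih k (by omega)).loopTerm
        (.sum _ fun m _ => (ih m (by omega)).treeTerm (ih (k - m) (by omega))))

theorem loopTerm_sub {N : ℕ} (f g : SourceSeries N) :
    loopTerm (f - g) = loopTerm f - loopTerm g := by
  simp only [loopTerm, map_sub, mul_sub, Finset.sum_sub_distrib]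

/-- Telescoping puts a difference of two flows into one factor of each product, as
`BalancedVanishing.treeTerm_of_mul` requires. -/
theorem treeTerm_sub_treeTerm {N : ℕ} (f g f' g' : SourceSeries N) :
    treeTerm f g - treeTerm f' g' = treeTerm (f - f') g + treeTerm f' (g - g') := by
  simp only [treeTerm, map_sub, mul_sub, sub_mul, Finset.sum_sub_distrib]
  ring

/-- A perturbation that vanishes on balanced graphs remains so along the flow. -/
theorem BalancedVanishing.flowCoeff_sub {K K' : (N : ℕ) → SourceSeries N} (hK : CoeffBounded K)
    (hK' : CoeffBounded K') (h : BalancedVanishing fun N => K N - K' N) (k : ℕ) :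
    BalancedVanishing fun N => flowCoeff 0 (K N) k - flowCoeff 0 (K' N) k := by
  induction k using Nat.strong_induction_on with
  | _ k ih =>
    cases k with
    | zero =>
      simp only [ReplicaWigner.flowCoeff]
      exact h
    | succ k =>
      simp only [ReplicaWigner.flowCoeff, map_zero, zero_mul, zero_add, ← mul_sub,
        add_sub_add_comm, ← loopTerm_sub, ← Finset.sum_sub_distrib, treeTerm_sub_treeTerm]
      refine .C_mul _ (.add (ih k (by omega)).loopTerm (.sum _ fun m _ => .add ?_ ?_))
      · exact .treeTerm_of_mul ((hK.flowCoeff m).sub (hK'.flowCoeff m)) (hK.flowCoeff (k - m))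
          (Or.inl (ih m (by omega)))
      · exact .treeTerm_of_mul (hK'.flowCoeff m)
          ((hK.flowCoeff (k - m)).sub (hK'.flowCoeff (k - m))) (Or.inr (ih (k - m) (by omega)))

end Asymptotics

/-! ### Rank and balance of a graph -/

section GraphRank

namespace OrientedGraph

variable {N : ℕ}

/-- The differences of target and source of the edges, as the rows of a matrix. -/
def incidence (G : OrientedGraph) : Matrix (Fin G.e) (Fin G.v) ℚ :=
  Matrix.of fun a => Pi.single (G.tgt a) 1 - Pi.single (G.src a) 1

/-- The kernel consists of the functions on vertices that agree at the two ends of every edge, that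
is, of the functions on the set of components. -/
theorem finrank_ker_incidence (G : OrientedGraph) :
    Module.finrank ℚ (LinearMap.ker G.incidence.mulVecLin) = G.c := by
  classical
  let r : Fin G.v → Fin G.v → Prop := fun x y => ∃ a, G.src a = x ∧ G.tgt a = y
  have hfin : Fintype (Quot r) := Fintype.ofFinite _
  have hinj : Function.Injective (LinearMap.funLeft ℚ ℚ (Quot.mk r)) :=
    LinearMap.funLeft_injective_of_surjective ℚ ℚ _ Quot.mk_surjective
  have hmul : ∀ x a, G.incidence.mulVecLin x a = x (G.tgt a) - x (G.src a) := by
    intro x a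
    change (Pi.single (G.tgt a) 1 - Pi.single (G.src a) 1 : Fin G.v → ℚ) ⬝ᵥ x = _
    rw [sub_dotProduct, single_one_dotProduct, single_one_dotProduct]
  have hker : LinearMap.ker G.incidence.mulVecLin =
      LinearMap.range (LinearMap.funLeft ℚ ℚ (Quot.mk r)) := by
    ext x
    rw [LinearMap.mem_ker, LinearMap.mem_range]
    constructor
    · intro hx
      refine ⟨Quot.lift x ?_, rfl⟩
      rintro _ _ ⟨a, rfl, rfl⟩
      have := congrFun hx a
      rw [hmul] at this
      exact (sub_eq_zero.mp this).symm
    · rintro ⟨y, rfl⟩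
      funext a
      rw [hmul]
      simp only [LinearMap.funLeft_apply, Pi.zero_apply]
      rw [Quot.sound (show r (G.src a) (G.tgt a) from ⟨a, rfl, rfl⟩), sub_self]
  rw [hker, LinearMap.finrank_range_of_inj hinj, Module.finrank_fintype_fun_eq_card, c,
    Nat.card_eq_fintype_card]

theorem rank_incidence_add_c (G : OrientedGraph) : G.incidence.rank + G.c = G.v := by
  have h := G.incidence.mulVecLin.finrank_range_add_finrank_ker
  rw [finrank_ker_incidence] at h
  rw [Matrix.rank, h]
  simp

theorem edgeSpan_edgeExponent (G : OrientedGraph) (i : Fin G.v ↪ Fin N) :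
    edgeSpan (edgeExponent G i) =
      (Submodule.span ℚ (Set.range G.incidence.row)).map (Function.ExtendByZero.linearMap ℚ i) := by
  have hsupp : ((edgeExponent G i).support : Set (Fin N × Fin N)) = Set.range (G.edgePair i) := by
    ext p
    rw [Finset.mem_coe, Finsupp.mem_support_iff, edgeExponent_apply, Ne, Fintype.card_eq_zero_iff,
      not_isEmpty_iff]
    exact ⟨fun ⟨a⟩ => ⟨a.1, a.2⟩, fun ⟨a, ha⟩ => ⟨a, ha⟩⟩
  have hsingle : ∀ x : Fin G.v, Function.ExtendByZero.linearMap ℚ i (Pi.single x 1) =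
      Pi.single (i x) (1 : ℚ) := by
    intro x
    funext y
    rw [Function.ExtendByZero.linearMap_apply]
    by_cases hy : ∃ z, i z = y
    · obtain ⟨z, rfl⟩ := hy
      rw [i.injective.extend_apply]
      simp [Pi.single_apply, i.injective.eq_iff]
    · rw [Function.extend_apply' _ _ _ hy, Pi.single_apply, if_neg fun h => hy ⟨x, h.symm⟩]
      rfl
  rw [edgeSpan, hsupp, Submodule.map_span, ← Set.range_comp, ← Set.range_comp]
  congr 2
  funext a
  change Pi.single (i (G.tgt a)) 1 - Pi.single (i (G.src a)) 1 =
    Function.ExtendByZero.linearMap ℚ i (Pi.single (G.tgt a) 1 - Pi.single (G.src a) 1)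
  rw [map_sub, hsingle, hsingle]

/-- Rank-nullity for the incidence matrix; extension by zero along the injective labeling preserves
the dimension. This identifies the linear-algebraic exponent with that of `scaling`. -/
theorem forestRank_edgeExponent (G : OrientedGraph) (i : Fin G.v ↪ Fin N) :
    forestRank (edgeExponent G i) + G.c = G.v := by
  have hinj : Function.Injective (Function.ExtendByZero.linearMap ℚ (i : Fin G.v → Fin N)) := by
    intro x y h
    funext z
    have := congrFun h (i z)
    simpa [Function.ExtendByZero.linearMap_apply, i.injective.extend_apply] using this
  refine Eq.trans ?_ G.rank_incidence_add_c
  rw [forestRank, edgeSpan_edgeExponent, Matrix.rank_eq_finrank_span_row,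
    (Submodule.equivMapOfInjective _ hinj _).finrank_eq]

theorem imbalance_edgeExponent (G : OrientedGraph) (i : Fin G.v ↪ Fin N) :
    imbalance (edgeExponent G i) = ∑ a, edgeVector (G.edgePair i a) := by
  classical
  simp only [imbalance, edgeExponent, Finsupp.coe_finsetSum, Finset.sum_apply, Nat.cast_sum,
    Finset.sum_smul]
  rw [Finset.sum_comm]
  refine Finset.sum_congr rfl fun a _ => ?_
  simp [Finsupp.single_apply, edgePair]

theorem imbalance_edgeExponent_eq_zero_iff (G : OrientedGraph) (i : Fin G.v ↪ Fin N) :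
    imbalance (edgeExponent G i) = 0 ↔ G.IsEulerian := by
  classical
  have hx : ∀ y, imbalance (edgeExponent G i) y =
      (Nat.card {a // i (G.tgt a) = y} : ℚ) - Nat.card {a // i (G.src a) = y} := by
    intro y
    rw [imbalance_edgeExponent, Finset.sum_apply]
    simp only [edgeVector, edgePair, Pi.sub_apply, Finset.sum_sub_distrib, Pi.single_apply,
      Finset.sum_boole, Nat.card_eq_fintype_card, Fintype.card_subtype, eq_comm (a := y)]
  constructor
  · intro h x
    have := hx (i x)
    simp only [h, Pi.zero_apply, i.injective.eq_iff] at this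
    exact_mod_cast (sub_eq_zero.mp this.symm)
  · intro h
    funext y
    rw [hx, Pi.zero_apply, sub_eq_zero, Nat.cast_inj]
    by_cases hy : ∃ x, i x = y
    · obtain ⟨x, rfl⟩ := hy
      simpa only [i.injective.eq_iff] using h x
    · have h1 : IsEmpty {a // i (G.tgt a) = y} := ⟨fun a => hy ⟨_, a.2⟩⟩
      have h2 : IsEmpty {a // i (G.src a) = y} := ⟨fun a => hy ⟨_, a.2⟩⟩
      simp

/-- Scaled cumulants and scaled coefficients differ only by factorials of multiplicities, whose
product lies between 1 and `e!`. -/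
theorem scaling_mul_norm (f : SourceSeries N) (G : OrientedGraph) (i : Fin G.v ↪ Fin N) :
    G.scaling N * ‖graphCumulant f G i‖ =
      (∏ p, ((edgeExponent G i p).factorial : ℝ)) * scaledCoeff f (edgeExponent G i) := by
  have h : (G.v : ℝ) - G.c = forestRank (edgeExponent G i) := by
    rw [sub_eq_iff_eq_add]
    exact_mod_cast (G.forestRank_edgeExponent i).symm
  rw [scaling, scaledCoeff, degree_edgeExponent, h, graphCumulant, norm_mul, norm_prod]
  simp only [Complex.norm_natCast]
  ring

theorem scaledCoeff_le (f : SourceSeries N) (G : OrientedGraph) (i : Fin G.v ↪ Fin N) :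
    scaledCoeff f (edgeExponent G i) ≤ G.scaling N * ‖graphCumulant f G i‖ := by
  rw [scaling_mul_norm]
  refine le_mul_of_one_le_left (scaledCoeff_nonneg _ _) ?_
  have : 1 ≤ ∏ p, (edgeExponent G i p).factorial :=
    Finset.one_le_prod' fun p _ => Nat.one_le_iff_ne_zero.mpr (Nat.factorial_ne_zero _)
  exact_mod_cast this

theorem scaling_mul_norm_le (f : SourceSeries N) (G : OrientedGraph) (i : Fin G.v ↪ Fin N) :
    G.scaling N * ‖graphCumulant f G i‖ ≤
      (G.e.factorial : ℝ) * scaledCoeff f (edgeExponent G i) := by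
  rw [scaling_mul_norm]
  refine mul_le_mul_of_nonneg_right ?_ (scaledCoeff_nonneg _ _)
  have h := Nat.le_of_dvd (Nat.factorial_pos _)
    (Nat.prod_factorial_dvd_factorial_sum Finset.univ fun p => edgeExponent G i p)
  rw [← Finsupp.degree_eq_sum, degree_edgeExponent] at h
  exact_mod_cast h

theorem v_le (G : OrientedGraph) : G.v ≤ 2 * G.e := by
  classical
  have h : (Finset.univ : Finset (Fin G.v)) ⊆
      Finset.univ.image G.src ∪ Finset.univ.image G.tgt := by
    intro x _
    obtain ⟨a, rfl | rfl⟩ := G.no_isolated x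
    · exact Finset.mem_union_left _ (Finset.mem_image_of_mem _ (Finset.mem_univ a))
    · exact Finset.mem_union_right _ (Finset.mem_image_of_mem _ (Finset.mem_univ a))
  have h1 := Finset.card_le_card h
  have h2 := Finset.card_union_le (Finset.univ.image G.src) (Finset.univ.image G.tgt)
  have h3 := Finset.card_image_le (s := Finset.univ) (f := G.src)
  have h4 := Finset.card_image_le (s := Finset.univ) (f := G.tgt)
  simp only [Finset.card_univ, Fintype.card_fin] at h1 h3 h4
  omega

/-- Without isolated vertices `v ≤ 2 * e`. Finiteness converts bounds for each graph separately into
bounds uniform over all monomials of bounded degree. -/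
theorem finite_setOf_e_le (E : ℕ) : {G : OrientedGraph | G.e ≤ E}.Finite := by
  let F : (Σ (v : Fin (2 * E + 1)) (e : Fin (E + 1)),
      {f : (Fin e.1 → Fin v.1) × (Fin e.1 → Fin v.1) // ∀ x, ∃ a, f.1 a = x ∨ f.2 a = x}) →
        OrientedGraph := fun x => ⟨x.1.1, x.2.1.1, x.2.2.1.1, x.2.2.1.2, x.2.2.2⟩
  refine (Set.finite_range F).subset fun G hG => ?_
  have hv := G.v_le
  rw [Set.mem_ofPred_eq] at hG
  exact ⟨⟨⟨G.v, by omega⟩, ⟨G.e, by omega⟩, ⟨(G.src, G.tgt), G.no_isolated⟩⟩, rfl⟩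

end OrientedGraph

end GraphRank

/-! ### Asymptotics of graph cumulants -/

section Transfer

open MvPowerSeries

namespace OrientedGraph

/-- Below the threshold there are finitely many `N`, each with finitely many labelings, so the sum
of all their values is a bound. -/
theorem UniformlyVanishing.uniformlyBounded {G : OrientedGraph}
    {f : (N : ℕ) → (Fin G.v ↪ Fin N) → ℂ} (h : G.UniformlyVanishing f) : G.UniformlyBounded f := by
  obtain ⟨N₀, hN₀⟩ := h 1 one_pos
  refine ⟨1 + ∑ N ∈ Finset.range N₀, ∑ i : Fin G.v ↪ Fin N, G.scaling N * ‖f N i‖,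
    fun N _ i => ?_⟩
  have hs : ∀ N, 0 ≤ G.scaling N := fun N => by
    rw [scaling]
    positivity
  have hpos : ∀ N, 0 ≤ ∑ i : Fin G.v ↪ Fin N, G.scaling N * ‖f N i‖ := fun N =>
    Finset.sum_nonneg fun i _ => mul_nonneg (hs N) (norm_nonneg _)
  by_cases hN : N₀ ≤ N
  · have := hN₀ N hN i
    have := Finset.sum_nonneg fun N (_ : N ∈ Finset.range N₀) => hpos N
    linarith
  · have h1 := Finset.single_le_sum (f := fun i : Fin G.v ↪ Fin N => G.scaling N * ‖f N i‖)
      (fun i _ => mul_nonneg (hs N) (norm_nonneg _)) (Finset.mem_univ i)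
    have h2 := Finset.single_le_sum
      (f := fun N => ∑ i : Fin G.v ↪ Fin N, G.scaling N * ‖f N i‖)
      (fun N _ => hpos N) (Finset.mem_range.mpr (not_le.mp hN))
    linarith

end OrientedGraph

variable {f : (N : ℕ) → SourceSeries N}

theorem CoeffBounded.of_graphs
    (h : ∀ G : OrientedGraph, G.UniformlyBounded fun N i => graphCumulant (f N) G i) :
    CoeffBounded f := by
  intro e
  choose B hB using h
  have hfin := OrientedGraph.finite_setOf_e_le e
  refine ⟨∑ G ∈ hfin.toFinset, |B G|, fun N hN d hd => ?_⟩
  obtain ⟨G, i, rfl⟩ := OrientedGraph.exists_edgeExponent_eq d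
  rw [G.degree_edgeExponent] at hd
  calc _ ≤ _ := G.scaledCoeff_le (f N) i
    _ ≤ B G := hB G N hN i
    _ ≤ |B G| := le_abs_self _
    _ ≤ _ := Finset.single_le_sum (f := fun G => |B G|) (fun G _ => abs_nonneg _)
      (hfin.mem_toFinset.mpr hd)

theorem BalancedVanishing.of_graphs
    (h : ∀ G : OrientedGraph, G.IsEulerian →
      G.UniformlyVanishing fun N i => graphCumulant (f N) G i) : BalancedVanishing f := by
  intro e ε hε
  have h' : ∀ G : OrientedGraph, ∃ N₀ : ℕ, G.IsEulerian → ∀ N : ℕ, N₀ ≤ N →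
      ∀ i : Fin G.v ↪ Fin N, G.scaling N * ‖graphCumulant (f N) G i‖ ≤ ε := by
    intro G
    by_cases hG : G.IsEulerian
    · obtain ⟨N₀, hN₀⟩ := h G hG ε hε
      exact ⟨N₀, fun _ => hN₀⟩
    · exact ⟨0, fun h => absurd h hG⟩
  choose N₀ hN₀ using h'
  have hfin := OrientedGraph.finite_setOf_e_le e
  refine ⟨hfin.toFinset.sup N₀, fun N _ hNN d hd hb => ?_⟩
  obtain ⟨G, i, rfl⟩ := OrientedGraph.exists_edgeExponent_eq d
  rw [G.degree_edgeExponent] at hd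
  rw [G.imbalance_edgeExponent_eq_zero_iff] at hb
  exact (G.scaledCoeff_le (f N) i).trans
    (hN₀ G hb N ((Finset.le_sup (hfin.mem_toFinset.mpr hd)).trans hNN) i)

theorem CoeffBounded.uniformlyBounded (hf : CoeffBounded f) (G : OrientedGraph) :
    G.UniformlyBounded fun N i => graphCumulant (f N) G i := by
  obtain ⟨B, hB⟩ := hf G.e
  exact ⟨G.e.factorial * B, fun N hN i => (G.scaling_mul_norm_le (f N) i).trans
    (mul_le_mul_of_nonneg_left (hB N hN _ (G.degree_edgeExponent i).le) (by positivity))⟩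

theorem BalancedVanishing.uniformlyVanishing (hf : BalancedVanishing f) {G : OrientedGraph}
    (hG : G.IsEulerian) : G.UniformlyVanishing fun N i => graphCumulant (f N) G i := by
  intro ε hε
  have hpos : (0 : ℝ) < G.e.factorial := by exact_mod_cast G.e.factorial_pos
  obtain ⟨N₀, h⟩ := hf G.e (ε / G.e.factorial) (div_pos hε hpos)
  refine ⟨max 1 N₀, fun N hN i => (G.scaling_mul_norm_le (f N) i).trans ?_⟩
  have := h N ((le_max_left _ _).trans hN) ((le_max_right _ _).trans hN) _
    (G.degree_edgeExponent i).le ((G.imbalance_edgeExponent_eq_zero_iff i).mpr hG)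
  rwa [le_div_iff₀' hpos] at this

/-- Only the monomials `J i j * J j i` occur. They have degree 2 and rank at most 1, since their two
edge vectors are opposite, so the exponent of `N` is not positive. -/
theorem coeffBounded_gaussianSeries (α : ℝ) : CoeffBounded fun N => gaussianSeries N α := by
  classical
  intro e
  refine ⟨‖(α : ℂ) ^ 2 / 2‖ * e, fun N hN d hd => ?_⟩
  have hN1 : (1 : ℝ) ≤ N := by exact_mod_cast hN
  have hd' : (d.degree : ℝ) ≤ e := by exact_mod_cast hd
  beta_reduce
  rw [gaussianSeries, scaledCoeff_C_mul]
  refine mul_le_mul_of_nonneg_left (le_trans ?_ hd') (norm_nonneg _)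
  have hmon : ∀ i j : Fin N, (X (i, j) * X (j, i) : SourceSeries N) =
      monomial (Finsupp.single (i, j) 1 + Finsupp.single (j, i) 1) 1 := by
    intro i j
    rw [X, X, monomial_mul_monomial, one_mul]
  have hterm : ∀ i j : Fin N, (N : ℝ) ^ ((forestRank d : ℝ) - (d.degree : ℝ) / 2) *
      ‖coeff d (X (i, j) * X (j, i) : SourceSeries N)‖ ≤ if (i, j) ∈ d.support then 1 else 0 := by
    intro i j
    rw [hmon, coeff_monomial]
    by_cases h : d = Finsupp.single (i, j) 1 + Finsupp.single (j, i) 1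
    · have hmem : (i, j) ∈ d.support := by
        rw [h]
        simp
      rw [if_pos h, if_pos hmem, norm_one, mul_one]
      have hdeg : (d.degree : ℝ) = 2 := by
        rw [h, map_add, Finsupp.degree_single, Finsupp.degree_single]
        norm_num
      have hspan : edgeSpan d ≤ Submodule.span ℚ {edgeVector (i, j)} := by
        rw [h, edgeSpan_add]
        have hself := Submodule.mem_span_singleton_self (R := ℚ) (edgeVector (i, j))
        refine sup_le (edgeSpan_le.mpr fun p hp => ?_) (edgeSpan_le.mpr fun p hp => ?_)
        · rw [Finsupp.single_apply] at hp
          split_ifs at hp with hp'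
          · rwa [← hp']
          · exact absurd rfl hp
        · rw [Finsupp.single_apply] at hp
          split_ifs at hp with hp'
          · rw [← hp', show edgeVector (j, i) = -edgeVector (i, j) by simp [edgeVector]]
            exact Submodule.neg_mem _ hself
          · exact absurd rfl hp
      have hrank : forestRank d ≤ 1 :=
        (Submodule.finrank_mono hspan).trans ((finrank_span_le_card _).trans (by simp))
      have hrank' : (forestRank d : ℝ) ≤ 1 := by exact_mod_cast hrank
      exact Real.rpow_le_one_of_one_le_of_nonpos hN1 (by linarith)
    · rw [if_neg h, norm_zero, mul_zero]
      split_ifs <;> norm_num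
  rw [scaledCoeff]
  simp only [map_sum]
  calc _ ≤ (N : ℝ) ^ ((forestRank d : ℝ) - (d.degree : ℝ) / 2) *
        ∑ i, ∑ j, ‖coeff d (X (i, j) * X (j, i) : SourceSeries N)‖ := by
        gcongr
        exact (norm_sum_le _ _).trans (Finset.sum_le_sum fun i _ => norm_sum_le _ _)
    _ ≤ ∑ i, ∑ j, if (i, j) ∈ d.support then (1 : ℝ) else 0 := by
        simp only [Finset.mul_sum]
        exact Finset.sum_le_sum fun i _ => Finset.sum_le_sum fun j _ => hterm i j
    _ = d.support.card := by
        rw [← Fintype.sum_prod_type' fun i j => if (i, j) ∈ d.support then (1 : ℝ) else 0]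
        simp only [Prod.mk.eta]
        rw [Finset.sum_ite_mem, Finset.univ_inter, Finset.sum_const, nsmul_eq_mul, mul_one]
    _ ≤ _ := by exact_mod_cast card_support_le_degree d

end Transfer

/-! ### The two parts of the effective potential as source series -/

section Potential

theorem coeff_gaussianPart {N : ℕ} (n k : ℕ) (α : ℝ) :
    PowerSeries.coeff k (gaussianPart N n α) =
      bareHom N n (flowCoeff n (gaussianSeries N α) k) := by
  rw [gaussianPart, effectivePotential, PowerSeries.coeff_mk, effCoeff_barePotential]

theorem coeff_perturbedPart {N : ℕ} (n k : ℕ) (α : ℝ) (K : SourceSeries N) :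
    PowerSeries.coeff k (perturbedPart n α K) =
      bareHom N n (flowCoeff n K k - flowCoeff n (gaussianSeries N α) k) := by
  rw [perturbedPart, map_sub, coeff_gaussianPart, effectivePotential, PowerSeries.coeff_mk,
    effCoeff_barePotential, map_sub]

theorem DependsPolynomially.sub {σ : Type*} {F F' : ℂ → MvPowerSeries σ ℂ}
    (h : DependsPolynomially F) (h' : DependsPolynomially F') :
    DependsPolynomially fun z => F z - F' z := by
  intro d
  obtain ⟨p, hp⟩ := h d
  obtain ⟨q, hq⟩ := h' d
  exact ⟨p - q, fun z => by simp [hp, hq]⟩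

theorem graphCumulant_sub {N : ℕ} (K K' : SourceSeries N) (G : OrientedGraph)
    (i : Fin G.v ↪ Fin N) :
    graphCumulant (K - K') G i = graphCumulant K G i - graphCumulant K' G i := by
  rw [graphCumulant, graphCumulant, graphCumulant, map_sub, mul_sub]

end Potential

end ReplicaWigner

end

/-! ### Proof of the proposition -/

theorem proposition1
    (Ω : ℕ → Type*) [∀ N, MeasurableSpace (Ω N)]
    (P : (N : ℕ) → Measure (Ω N)) [∀ N, IsProbabilityMeasure (P N)]
    (M : (N : ℕ) → Ω N → Matrix (Fin N) (Fin N) ℂ)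
    (hHerm : ∀ N, ∀ᵐ ω ∂(P N), (M N ω).IsHermitian)
    (hMoments : ∀ N (i j : Fin N) (p : ℕ), MemLp (fun ω => M N ω i j) p (P N))
    (α : ℝ)
    (hEulerian : ∀ G : ReplicaWigner.OrientedGraph, G.IsEulerian →
      G.UniformlyVanishing fun N i =>
        ReplicaWigner.graphCumulant (ReplicaWigner.cumulantSeries (P N) (M N)) G i -
          ReplicaWigner.graphCumulant (ReplicaWigner.gaussianSeries N α) G i)
    (hNonEulerian : ∀ G : ReplicaWigner.OrientedGraph, ¬ G.IsEulerian →
      G.UniformlyBounded fun N i =>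
        ReplicaWigner.graphCumulant (ReplicaWigner.cumulantSeries (P N) (M N)) G i -
          ReplicaWigner.graphCumulant (ReplicaWigner.gaussianSeries N α) G i) :
    (∀ N : ℕ, 1 ≤ N → ∀ k : ℕ,
      (∃ C' : ReplicaWigner.GraphCoeff N, ReplicaWigner.IsGraphExpansion
        (fun n => PowerSeries.coeff k (ReplicaWigner.gaussianPart N n α)) C') ∧
      (∃ C'' : ReplicaWigner.GraphCoeff N, ReplicaWigner.IsGraphExpansion
        (fun n => PowerSeries.coeff k (ReplicaWigner.perturbedPart n α
          (ReplicaWigner.cumulantSeries (P N) (M N)))) C'')) ∧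
    ∀ C' C'' : (N : ℕ) → ℕ → ReplicaWigner.GraphCoeff N,
      (∀ N : ℕ, 1 ≤ N → ∀ k : ℕ, ReplicaWigner.IsGraphExpansion
        (fun n => PowerSeries.coeff k (ReplicaWigner.gaussianPart N n α)) (C' N k)) →
      (∀ N : ℕ, 1 ≤ N → ∀ k : ℕ, ReplicaWigner.IsGraphExpansion
        (fun n => PowerSeries.coeff k (ReplicaWigner.perturbedPart n α
          (ReplicaWigner.cumulantSeries (P N) (M N)))) (C'' N k)) →
      ∀ (k : ℕ) (G : ReplicaWigner.OrientedGraph),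
        (G.UniformlyBounded fun N i => (C' N k G i).coeff 0) ∧
        (G.IsEulerian → G.UniformlyVanishing fun N i => (C'' N k G i).coeff 0) ∧
        (¬ G.IsEulerian → G.UniformlyBounded fun N i => (C'' N k G i).coeff 0) := by
  have hbase : ∀ (G : ReplicaWigner.OrientedGraph) (N : ℕ) (i : Fin G.v ↪ Fin N),
      ReplicaWigner.graphCumulant (ReplicaWigner.cumulantSeries (P N) (M N)) G i -
        ReplicaWigner.graphCumulant (ReplicaWigner.gaussianSeries N α) G i =
      ReplicaWigner.graphCumulant (ReplicaWigner.cumulantSeries (P N) (M N) -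
        ReplicaWigner.gaussianSeries N α) G i := fun G N i =>
    (ReplicaWigner.graphCumulant_sub _ _ G i).symm
  simp only [hbase] at hEulerian hNonEulerian
  have hV := ReplicaWigner.BalancedVanishing.of_graphs hEulerian
  have hB : ReplicaWigner.CoeffBounded fun N =>
      ReplicaWigner.cumulantSeries (P N) (M N) - ReplicaWigner.gaussianSeries N α := by
    refine .of_graphs fun G => ?_
    by_cases hG : G.IsEulerian
    · exact (hEulerian G hG).uniformlyBounded
    · exact hNonEulerian G hG
  have hgauss := ReplicaWigner.coeffBounded_gaussianSeries α
  -- The flow is nonlinear, so its difference is controlled through bounds on both full initial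
  -- values, not on the perturbation alone.
  have hK : ReplicaWigner.CoeffBounded fun N => ReplicaWigner.cumulantSeries (P N) (M N) := by
    simpa only [sub_add_cancel] using hB.add hgauss
  have hpoly : ∀ (N k : ℕ), ReplicaWigner.DependsPolynomially fun z =>
      ReplicaWigner.flowCoeff z (ReplicaWigner.cumulantSeries (P N) (M N)) k -
        ReplicaWigner.flowCoeff z (ReplicaWigner.gaussianSeries N α) k := fun N k =>
    (ReplicaWigner.dependsPolynomially_flowCoeff _ k).sub
      (ReplicaWigner.dependsPolynomially_flowCoeff _ k)
  refine ⟨fun N hN k => ⟨?_, ?_⟩, fun C' C'' hC' hC'' k G => ?_⟩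
  · exact ReplicaWigner.exists_isGraphExpansion (ReplicaWigner.dependsPolynomially_flowCoeff _ k)
      fun n => ReplicaWigner.coeff_gaussianPart n k α
  · exact ReplicaWigner.exists_isGraphExpansion (hpoly N k)
      fun n => ReplicaWigner.coeff_perturbedPart n k α _
  have h' : ∀ N, 1 ≤ N → ∀ i : Fin G.v ↪ Fin N, (C' N k G i).coeff 0 =
      ReplicaWigner.graphCumulant
        (ReplicaWigner.flowCoeff 0 (ReplicaWigner.gaussianSeries N α) k) G i := fun N hN i =>
    ReplicaWigner.eq_of_isGraphExpansion hN (ReplicaWigner.dependsPolynomially_flowCoeff _ k)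
      (fun n => ReplicaWigner.coeff_gaussianPart n k α) (hC' N hN k) G i
  have h'' : ∀ N, 1 ≤ N → ∀ i : Fin G.v ↪ Fin N, (C'' N k G i).coeff 0 =
      ReplicaWigner.graphCumulant
        (ReplicaWigner.flowCoeff 0 (ReplicaWigner.cumulantSeries (P N) (M N)) k -
          ReplicaWigner.flowCoeff 0 (ReplicaWigner.gaussianSeries N α) k) G i := fun N hN i =>
    ReplicaWigner.eq_of_isGraphExpansion hN (hpoly N k)
      (fun n => ReplicaWigner.coeff_perturbedPart n k α _) (hC'' N hN k) G i
  refine ⟨?_, fun hG ε hε => ?_, fun _ => ?_⟩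
  · obtain ⟨B, h⟩ := (hgauss.flowCoeff k).uniformlyBounded G
    exact ⟨B, fun N hN i => by beta_reduce; rw [h' N hN]; exact h N hN i⟩
  · obtain ⟨N₀, h⟩ := (ReplicaWigner.BalancedVanishing.flowCoeff_sub hK hgauss hV k
      ).uniformlyVanishing hG ε hε
    -- The maximum with 1 excludes `N = 0`, where nothing is assumed about the candidate
    -- coefficients.
    refine ⟨max 1 N₀, fun N hN i => ?_⟩
    beta_reduce
    rw [h'' N ((le_max_left _ _).trans hN)]
    exact h N ((le_max_right _ _).trans hN) i
  · obtain ⟨B, h⟩ := ((hK.flowCoeff k).sub (hgauss.flowCoeff k)).uniformlyBounded G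
    exact ⟨B, fun N hN i => by beta_reduce; rw [h'' N hN]; exact h N hN i⟩
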